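/- Let $g_1, g_2, \dots$ be an exchangeable sequence of real-valued random variables on a probability space $(\Omega, \mathcal F, \mathbb P)$ (for every $n$, the law of $(g_1,\dots,g_n)$ is invariant under permutations of the indices), and let $\mathcal T_* = \bigcap_{n} \sigma(g_n, g_{n+1}, \dots)$ be its tail $\sigma$-algebra. For $\varepsilon > 0$ and $t > 0$ put $$\Delta_t(\varepsilon) = \mathbb E\big(g_1 \mathbf 1_{\{|g_1| \le \varepsilon t\}} \,\big|\, \mathcal T_*\big), \qquad T_t(\varepsilon) = t\, \mathbb P\big(|g_1| > \varepsilon t \,\big|\, \mathcal T_*\big), \qquad \Sigma_t(\varepsilon) = \tfrac1t\, \mathbb E\big(g_1^2 \mathbf 1_{\{|g_1| \le \varepsilon t\}} \,\big|\, \mathcal T_*\big),$$ $$V_t(\varepsilon) = \tfrac1t\, \mathrm{Var}\big(g_1 \mathbf 1_{\{|g_1| \le \varepsilon t\}} \,\big|\, \mathcal T_*\big), \qquad R_t(\varepsilon) = \tfrac1t\, \mathbb E\big((|g_1| \wedge \varepsilon t)^2 \,\big|\, \mathcal T_*\big),$$ all computed from one regular conditional distribution of $g_1$ given $\mathcal T_*$.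 Then the following are equivalent. * (i) There exist real-valued, $\mathcal T_*$-measurable $D_1, D_2, \dots$ such that for every $\varepsilon > 0$, $\ \mathbb P\big(\big|\frac1N \sum_{n=1}^N g_n - D_N\big| > \varepsilon\big) \to 0$ as $N \to \infty$. * (i)$'$ There exist real-valued, $\mathcal T_*$-measurable $D_1, D_2, \dots$ such that for every $\varepsilon > 0$, $\ \mathbb P\big(\big|\frac1N \sum_{n=1}^N g_n - D_N\big| > \varepsilon \,\big|\, \mathcal T_*\big) \to 0$ in probability as $N \to \infty$. * (ii) For every $\varepsilon > 0$, both $T_t(\varepsilon) \to 0$ and $\Sigma_t(\varepsilon) \to 0$ in probability as $t \to \infty$. * (ii)$'$ For every $\varepsilon > 0$, both $T_t(\varepsilon) \to 0$ and $V_t(\varepsilon) \to 0$ in probability as $t \to \infty$. * (ii)$''$ For every $\varepsilon > 0$, $R_t(\varepsilon) \to 0$ in probability as $t \to \infty$. * (iii) For every $\varepsilon > 0$, $\frac1M \int_0^M T_t(\varepsilon)\, dt \to 0$ in probability as $M \to \infty$. * (iii)$'$ For every $\varepsilon > 0$, $M \int_M^\infty \Sigma_t(\varepsilon)\, t^{-2}\,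 dt \to 0$ in probability as $M \to \infty$. * (iii)$''$ For every $\varepsilon > 0$, $M \int_M^\infty V_t(\varepsilon)\, t^{-2}\, dt \to 0$ in probability as $M \to \infty$. When these equivalent conditions hold, the convergences in (i) and (i)$'$ both hold with $D_N = \Delta_N(1) = \mathbb E(g_1 \mathbf 1_{\{|g_1| \le N\}} \mid \mathcal T_*)$. Moreover, any sequence $(D_N)$ as in (i) or (i)$'$ satisfies $D_N / \sqrt N \to 0$ in probability. -/

import Mathlib

open MeasureTheory ProbabilityTheory Filter Topology

namespace ExchWLLN

noncomputable section

variable {Ω : Type*} [mΩ : MeasurableSpace Ω]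

/-- A sequence `g 0, g 1, …` of real random variables is exchangeable if, for every `n` and every
permutation `π` of the first `n` indices, the vectors `(g (π 0), …, g (π (n - 1)))` and
`(g 0, …, g (n - 1))` have the same law. -/
def Exchangeable (μ : Measure Ω) (g : ℕ → Ω → ℝ) : Prop :=
  ∀ (n : ℕ) (π : Equiv.Perm (Fin n)),
    μ.map (fun ω (i : Fin n) => g (π i) ω) = μ.map (fun ω (i : Fin n) => g i ω)

/-- The tail σ-algebra `⋂ n, σ(g n, g (n + 1), …)`. -/
@[reducible] def tail (g : ℕ → Ω → ℝ) : MeasurableSpace Ω :=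
  ⨅ n : ℕ, ⨆ k : ℕ, ⨆ _ : n ≤ k, MeasurableSpace.comap (g k) inferInstance

/-- The average of the first `N` terms of the sequence. -/
def avg (g : ℕ → Ω → ℝ) (N : ℕ) (ω : Ω) : ℝ :=
  (1 / (N : ℝ)) * ∑ n ∈ Finset.range N, g n ω

/-- The regular conditional distribution of the first term of the sequence given the tail
σ-algebra: a Markov kernel from `(Ω, tail g)` to `ℝ`. All the tail-conditional quantities below are
taken with respect to this kernel, which fixes, simultaneously for all truncation levels, versions
of the conditional expectations that are jointly measurable in the truncation level and `ω`. The
lemmas at the end of the file identify them with the conditional expectations they stand for. -/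
def tailLaw (μ : Measure Ω) [IsFiniteMeasure μ] (g : ℕ → Ω → ℝ) : @Kernel Ω ℝ (tail g) _ :=
  @condDistrib Ω Ω ℝ _ _ _ mΩ (tail g) (g 0) id μ _

/-- The truncation `x ↦ x 1_{|x| ≤ c}`. -/
def trunc (c x : ℝ) : ℝ := Set.indicator {y : ℝ | |y| ≤ c} (fun y => y) x

/-- `Δ_t(ε) = E(g₁ 1_{|g₁| ≤ ε t} | tail)`. -/
def condMean (μ : Measure Ω) [IsFiniteMeasure μ] (g : ℕ → Ω → ℝ) (ε t : ℝ) (ω : Ω) : ℝ :=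
  ∫ x, trunc (ε * t) x ∂(tailLaw μ g ω)

/-- `T_t(ε) = t P(|g₁| > ε t | tail)`. -/
def condTail (μ : Measure Ω) [IsFiniteMeasure μ] (g : ℕ → Ω → ℝ) (ε t : ℝ) (ω : Ω) : ℝ :=
  t * (tailLaw μ g ω).real {x : ℝ | ε * t < |x|}

/-- `Σ_t(ε) = (1/t) E(g₁² 1_{|g₁| ≤ ε t} | tail)`. -/
def condSecond (μ : Measure Ω) [IsFiniteMeasure μ] (g : ℕ → Ω → ℝ) (ε t : ℝ) (ω : Ω) : ℝ :=
  (1 / t) * ∫ x, Set.indicator {y : ℝ | |y| ≤ ε * t} (fun y => y ^ 2) x ∂(tailLaw μ g ω)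

/-- `V_t(ε) = (1/t) Var(g₁ 1_{|g₁| ≤ ε t} | tail)`. -/
def condVariance (μ : Measure Ω) [IsFiniteMeasure μ] (g : ℕ → Ω → ℝ) (ε t : ℝ) (ω : Ω) : ℝ :=
  (1 / t) * variance (trunc (ε * t)) (tailLaw μ g ω)

/-- `R_t(ε) = (1/t) E((|g₁| ∧ ε t)² | tail)`. -/
def condTruncSecond (μ : Measure Ω) [IsFiniteMeasure μ] (g : ℕ → Ω → ℝ) (ε t : ℝ) (ω : Ω) : ℝ :=
  (1 / t) * ∫ x, (min |x| (ε * t)) ^ 2 ∂(tailLaw μ g ω)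

/-- `D` is a sequence of tail-measurable correctors for which the weak law of large numbers
holds. -/
def WLLN (μ : Measure Ω) (g D : ℕ → Ω → ℝ) : Prop :=
  (∀ N, Measurable[tail g] (D N)) ∧
    ∀ ε : ℝ, 0 < ε → Tendsto (fun N : ℕ => μ.real {ω | ε < |avg g N ω - D N ω|}) atTop (𝓝 0)

/-- `D` is a sequence of tail-measurable correctors for which the conditional weak law of large
numbers holds: the conditional probabilities of deviation, given the tail σ-algebra, tend to zero
in probability. -/
def CondWLLN (μ : Measure Ω) (g D : ℕ → Ω → ℝ) : Prop :=
  (∀ N, Measurable[tail g] (D N)) ∧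
    ∀ ε : ℝ, 0 < ε → TendstoInMeasure μ
      (fun N : ℕ => μ⟦{ω | ε < |avg g N ω - D N ω|} | tail g⟧) atTop (fun _ => (0 : ℝ))

/-! The quantities above are versions of the conditional expectations that they stand for. -/

lemma tail_le {g : ℕ → Ω → ℝ} (hg : ∀ n, Measurable (g n)) : tail g ≤ mΩ := by
  refine (iInf_le _ 0).trans (iSup_le fun k => iSup_le fun _ => (hg k).comap_le)

lemma condExp_ae_eq_tailLaw (μ : Measure Ω) [IsFiniteMeasure μ] {g : ℕ → Ω → ℝ}
    (hg : ∀ n, Measurable (g n)) {f : ℝ → ℝ} (hf : Measurable f)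
    (hint : Integrable (fun ω => f (g 0 ω)) μ) :
    μ[fun ω => f (g 0 ω) | tail g] =ᵐ[μ] fun ω => ∫ x, f x ∂(tailLaw μ g ω) := by
  have h := @condExp_ae_eq_integral_condDistrib Ω Ω ℝ ℝ _ _ _ _ mΩ μ _ id (g 0) (tail g) _ _
    (measurable_id'' (tail_le hg)) (hg 0).aemeasurable f hf.stronglyMeasurable hint
  rwa [MeasurableSpace.comap_id] at h

lemma measurable_trunc (c : ℝ) : Measurable (trunc c) :=
  measurable_id.indicator (measurableSet_le measurable_norm measurable_const)

lemma abs_trunc_le (c x : ℝ) : |trunc c x| ≤ |c| := by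
  by_cases h : |x| ≤ c
  · simpa [trunc, Set.indicator, h] using h.trans (le_abs_self c)
  · simp [trunc, Set.indicator, h]

lemma memLp_trunc (μ : Measure Ω) [IsFiniteMeasure μ] {X : Ω → ℝ} (hX : Measurable X) (c : ℝ)
    (p : ENNReal) : MemLp (fun ω => trunc c (X ω)) p μ :=
  MemLp.of_bound ((measurable_trunc c).comp hX).aestronglyMeasurable |c|
    (Eventually.of_forall fun ω => by simpa using abs_trunc_le c (X ω))

lemma condMean_ae_eq (μ : Measure Ω) [IsFiniteMeasure μ] {g : ℕ → Ω → ℝ}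
    (hg : ∀ n, Measurable (g n)) (ε t : ℝ) :
    condMean μ g ε t =ᵐ[μ] μ[fun ω => trunc (ε * t) (g 0 ω) | tail g] :=
  (condExp_ae_eq_tailLaw μ hg (measurable_trunc _)
    ((memLp_trunc μ (hg 0) _ 1).integrable le_rfl)).symm

lemma condTail_ae_eq (μ : Measure Ω) [IsFiniteMeasure μ] {g : ℕ → Ω → ℝ}
    (hg : ∀ n, Measurable (g n)) (ε t : ℝ) :
    condTail μ g ε t =ᵐ[μ] fun ω => t * (μ⟦{ω | ε * t < |g 0 ω|} | tail g⟧) ω := by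
  have hs : MeasurableSet {x : ℝ | ε * t < |x|} :=
    measurableSet_lt measurable_const measurable_norm
  have h := condExp_ae_eq_tailLaw μ hg (f := {x : ℝ | ε * t < |x|}.indicator fun _ => 1)
    (measurable_const.indicator hs)
    (Integrable.indicator (s := {ω | ε * t < |g 0 ω|}) (integrable_const (1 : ℝ)) ((hg 0) hs))
  filter_upwards [h] with ω hω
  rw [integral_indicator_const _ hs, smul_eq_mul, mul_one] at hω
  rw [condTail, ← hω]
  rfl

lemma condSecond_ae_eq (μ : Measure Ω) [IsFiniteMeasure μ] {g : ℕ → Ω → ℝ}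
    (hg : ∀ n, Measurable (g n)) (ε t : ℝ) :
    condSecond μ g ε t =ᵐ[μ] fun ω => (1 / t) *
      (μ[{ω | |g 0 ω| ≤ ε * t}.indicator (fun ω => g 0 ω ^ 2) | tail g]) ω := by
  have hs : MeasurableSet {x : ℝ | |x| ≤ ε * t} :=
    measurableSet_le measurable_norm measurable_const
  have e : (fun ω => trunc (ε * t) (g 0 ω) ^ 2) =
      fun ω => {y : ℝ | |y| ≤ ε * t}.indicator (fun y => y ^ 2) (g 0 ω) := by
    funext ω
    by_cases h : |g 0 ω| ≤ ε * t <;> simp [trunc, Set.indicator, h]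
  have hi := (memLp_trunc μ (hg 0) (ε * t) 2).integrable_sq
  rw [e] at hi
  filter_upwards [condExp_ae_eq_tailLaw μ hg ((measurable_id.pow_const 2).indicator hs) hi]
    with ω hω
  rw [condSecond]
  exact congrArg _ hω.symm

lemma condVariance_ae_eq (μ : Measure Ω) [IsFiniteMeasure μ] {g : ℕ → Ω → ℝ}
    (hg : ∀ n, Measurable (g n)) (ε t : ℝ) :
    condVariance μ g ε t =ᵐ[μ] fun ω => (1 / t) *
      (Var[fun ω => trunc (ε * t) (g 0 ω); μ | tail g]) ω := by
  have h2 := memLp_trunc μ (hg 0) (ε * t) 2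
  filter_upwards [condVar_ae_eq_condExp_sq_sub_sq_condExp (tail_le hg) h2,
    condMean_ae_eq μ hg ε t,
    condExp_ae_eq_tailLaw μ hg ((measurable_trunc (ε * t)).pow_const 2) h2.integrable_sq]
    with ω h3 h4 h5
  have hK : IsProbabilityMeasure (tailLaw μ g ω) := by unfold tailLaw; infer_instance
  have hL : MemLp (trunc (ε * t)) 2 (tailLaw μ g ω) := memLp_trunc _ measurable_id (ε * t) 2
  rw [condVariance, variance_eq_sub hL, h3]
  congr 1
  change _ = (μ[fun ω => trunc (ε * t) (g 0 ω) ^ 2 | tail g]) ω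
    - (μ[fun ω => trunc (ε * t) (g 0 ω) | tail g]) ω ^ 2
  rw [h5, ← h4]
  rfl

lemma condTruncSecond_ae_eq (μ : Measure Ω) [IsFiniteMeasure μ] {g : ℕ → Ω → ℝ}
    (hg : ∀ n, Measurable (g n)) (ε t : ℝ) (hε : 0 < ε) (ht : 0 < t) :
    condTruncSecond μ g ε t =ᵐ[μ] fun ω => (1 / t) *
      (μ[fun ω => (min |g 0 ω| (ε * t)) ^ 2 | tail g]) ω := by
  have hm : Measurable fun x : ℝ => (min |x| (ε * t)) ^ 2 := by fun_prop
  have hi : Integrable (fun ω => (min |g 0 ω| (ε * t)) ^ 2) μ := by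
    refine Integrable.of_bound (hm.comp (hg 0)).aestronglyMeasurable ((ε * t) ^ 2)
      (Eventually.of_forall fun ω => ?_)
    have : 0 ≤ min |g 0 ω| (ε * t) := le_min (abs_nonneg _) (mul_pos hε ht).le
    rw [Real.norm_eq_abs, abs_of_nonneg (by positivity)]
    gcongr
    exact min_le_right _ _
  filter_upwards [condExp_ae_eq_tailLaw μ hg hm hi] with ω hω
  rw [condTruncSecond, ← hω]

end

end ExchWLLN

namespace ExchWLLN

variable {Ω : Type*} [mΩ : MeasurableSpace Ω] {μ : Measure Ω} {g : ℕ → Ω → ℝ}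

/-! ### Consequences of exchangeability for the law of the whole sequence -/

/-! Conditionally on the tail, the terms are i.i.d. with law `tailLaw` (de Finetti), so the theorem
is a conditional form of the classical weak law under truncation, and every condition is compared
with the one on R.

De Finetti's theorem comes from Hilbert space geometry. For bounded f the vectors f(g k) have a
constant Gram matrix, so their averages are Cauchy in L². The limit is tail-measurable and is
identified as the conditional expectation. In the integral of a product, one factor at a time is
then exchanged for fresh terms, averaged, and replaced by its conditional mean
(`Exchangeable.integral_tail_mul_prod`).

The truncation conditions are compared for each ω. One has R = Σ + ε² T, and by Fubini the averages
of T and Σ in (iii) and (iii)' are R/(2ε²) and R/2. Always V ≤ Σ, and conversely Σ ≤ 2V + 4K²/t when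
K is a quantile of the conditional law (`second_le_variance_trunc`). That quantile is random, but it
is bounded by a constant outside an event of small probability, which is enough for convergence in
probability.

Sufficiency: on the tail event R_N(1) < δ, a union bound shows that truncating the first N terms at
N rarely matters, and Chebyshev's inequality controls the truncated average around Δ_N(1).

Necessity: let φ be the conditional characteristic function. For |u| ≤ 1/N, the conditional mean of
cos(Nu(avg - D)) is at most |φ(u)|^N, because the corrector only contributes a phase. The weak law
thus makes |φ(u)|^N close to 1 on this interval. Integrating 1 - |φ|² over it bounds the truncated
second moment of the symmetrized law, and a quantile removes the symmetrization
(`truncSecond_le_of_charFun`).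

Finally Δ_N(1)²/N ≤ Σ_N(1) by Jensen, and any two sequences of correctors differ by a quantity
tending to 0 in probability; this gives the rate for D_N. -/

lemma Exchangeable.map_swap [IsFiniteMeasure μ] (hex : Exchangeable μ g)
    (hg : ∀ n, Measurable (g n)) (a b : ℕ) :
    μ.map (fun ω n => g (Equiv.swap a b n) ω) = μ.map (fun ω n => g n ω) := by
  rw [map_eq_iff_forall_finset_map_restrict_eq
    (measurable_pi_lambda _ fun n => hg _).aemeasurable
    (measurable_pi_lambda _ fun n => hg _).aemeasurable]
  intro I
  -- Exchangeability only speaks of initial segments, so I is enlarged to one that also contains a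
  -- and b.
  obtain ⟨n, hn⟩ : ∃ n, a < n ∧ b < n ∧ ∀ i ∈ I, i < n :=
    ⟨max (max a b) (I.sup id) + 1, by omega, by omega, fun i hi => by
      have := Finset.le_sup (f := id) hi
      simp only [id] at this
      omega⟩
  have hr : Measurable (fun (x : Fin n → ℝ) (i : I) => x ⟨i.1, hn.2.2 i.1 i.2⟩) := by fun_prop
  have key := congrArg (Measure.map (fun (x : Fin n → ℝ) (i : I) => x ⟨i.1, hn.2.2 i.1 i.2⟩))
    (hex n (Equiv.swap ⟨a, hn.1⟩ ⟨b, hn.2.1⟩))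
  rw [Measure.map_map hr (measurable_pi_lambda _ fun n => hg _),
    Measure.map_map hr (measurable_pi_lambda _ fun n => hg _)] at key
  refine (Eq.trans ?_ key).trans rfl
  congr 1
  ext ω i
  simp only [Finset.restrict, Function.comp, Equiv.swap_apply_def]
  split_ifs <;> simp_all [Fin.ext_iff]

lemma Exchangeable.integral_comp_swap {E : Type*} [NormedAddCommGroup E] [NormedSpace ℝ E]
    [IsFiniteMeasure μ] (hex : Exchangeable μ g) (hg : ∀ n, Measurable (g n)) (a b : ℕ)
    {H : (ℕ → ℝ) → E} (hH : StronglyMeasurable H) :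
    ∫ ω, H (fun n => g (Equiv.swap a b n) ω) ∂μ = ∫ ω, H (fun n => g n ω) ∂μ := by
  rw [← integral_map (φ := fun ω n => g (Equiv.swap a b n) ω)
    (measurable_pi_lambda _ fun n => hg _).aemeasurable hH.aestronglyMeasurable,
    hex.map_swap hg, integral_map (measurable_pi_lambda _ fun n => hg _).aemeasurable
    hH.aestronglyMeasurable]

lemma tail_le_comap_shift {Ω : Type*} (g : ℕ → Ω → ℝ) (m : ℕ) :
    tail g ≤ MeasurableSpace.comap (fun ω n => g (n + m) ω) inferInstance := by
  refine (iInf_le _ m).trans (iSup_le fun k => iSup_le fun hk => ?_)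
  obtain ⟨j, rfl⟩ : ∃ j, k = j + m := ⟨k - m, by omega⟩
  rintro _ ⟨s, hs, rfl⟩
  exact ⟨(fun x : ℕ → ℝ => x j) ⁻¹' s, measurable_pi_apply j hs, rfl⟩

/-- Doob–Dynkin factorization: a tail-measurable weight can be written without the first m terms, so
permuting those terms leaves it fixed. The values are complex because the weights will include
characters of the corrector. -/
lemma exists_eq_comp_shift {Ω : Type*} {g : ℕ → Ω → ℝ} {W : Ω → ℂ}
    (hW : Measurable[tail g] W) (m : ℕ) :
    ∃ F : (ℕ → ℝ) → ℂ, Measurable F ∧ ∀ ω, W ω = F (fun n => g (n + m) ω) := by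
  obtain ⟨F, hF, h⟩ := (hW.mono (tail_le_comap_shift g m) le_rfl).exists_eq_measurable_comp
  exact ⟨F, hF, fun ω => congrFun h ω⟩

/-- A term of the sequence can be exchanged for another one in the presence of tail-measurable
weights and of the remaining terms. -/
lemma Exchangeable.integral_tail_mul_prod_mul [IsFiniteMeasure μ] (hex : Exchangeable μ g)
    (hg : ∀ n, Measurable (g n)) {W : Ω → ℂ} (hW : Measurable[tail g] W) (s : Finset ℕ)
    {f : ℕ → ℝ → ℂ} (hf : ∀ i, Measurable (f i)) {φ : ℝ → ℂ} (hφ : Measurable φ) {a k : ℕ}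
    (ha : a ∉ s) (hk : k ∉ s) :
    ∫ ω, W ω * (∏ i ∈ s, f i (g i ω)) * φ (g a ω) ∂μ
      = ∫ ω, W ω * (∏ i ∈ s, f i (g i ω)) * φ (g k ω) ∂μ := by
  -- The shift passes both a and k, so the swap does not touch the weight.
  obtain ⟨F, hF, hWF⟩ := exists_eq_comp_shift hW (max a k + 1)
  have hH : Measurable fun x : ℕ → ℝ =>
      F (fun n => x (n + (max a k + 1))) * (∏ i ∈ s, f i (x i)) * φ (x a) := by
    fun_prop
  have h := hex.integral_comp_swap hg a k hH.stronglyMeasurable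
  simp only [Equiv.swap_apply_left] at h
  have e1 : ∀ n, Equiv.swap a k (n + (max a k + 1)) = n + (max a k + 1) := fun n =>
    Equiv.swap_apply_of_ne_of_ne (by omega) (by omega)
  have e2 : ∀ ω, ∏ i ∈ s, f i (g (Equiv.swap a k i) ω) = ∏ i ∈ s, f i (g i ω) := fun ω =>
    Finset.prod_congr rfl fun i hi => by
      rw [Equiv.swap_apply_of_ne_of_ne (by rintro rfl; exact ha hi) (by rintro rfl; exact hk hi)]
  simp only [e1, e2, ← hWF] at h
  exact h.symm

/-! ### Averages of vectors with constant Gram matrix -/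

section Hilbert

variable {E : Type*} [NormedAddCommGroup E] [InnerProductSpace ℝ E]

lemma inner_sum_range_of_constant_gram {u : ℕ → E} {a b : ℝ} (ha : ∀ i, inner ℝ (u i) (u i) = a)
    (hb : ∀ i j, i ≠ j → inner ℝ (u i) (u j) = b) {m n : ℕ} (hmn : m ≤ n) :
    inner ℝ (∑ i ∈ Finset.range m, u i) (∑ j ∈ Finset.range n, u j)
      = m * ((a - b) + n * b) := by
  have h : ∀ i ∈ Finset.range m,
      inner ℝ (u i) (∑ j ∈ Finset.range n, u j) = (a - b) + n * b := fun i hi => by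
    have h2 : ∀ j ∈ Finset.range n, inner ℝ (u i) (u j) = (if i = j then a - b else 0) + b :=
      fun j _ => by
        by_cases hij : i = j
        · subst hij; rw [ha]; simp
        · simp [hij, hb i j hij]
    rw [inner_sum, Finset.sum_congr rfl h2, Finset.sum_add_distrib, Finset.sum_ite_eq]
    have : i < n := (Finset.mem_range.1 hi).trans_le hmn
    simp [this]
  rw [sum_inner, Finset.sum_congr rfl h, Finset.sum_const, Finset.card_range, nsmul_eq_mul]

/-- For m ≤ n the inner product of the two averages is ‖average n‖², as for an orthogonal
projection, so the squared distance is a difference of squared norms. -/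
lemma norm_sub_sq_average_of_constant_gram {u : ℕ → E} {a b : ℝ}
    (ha : ∀ i, inner ℝ (u i) (u i) = a) (hb : ∀ i j, i ≠ j → inner ℝ (u i) (u j) = b)
    {m n : ℕ} (hm : 0 < m) (hmn : m ≤ n) :
    ‖(n : ℝ)⁻¹ • ∑ i ∈ Finset.range n, u i - (m : ℝ)⁻¹ • ∑ i ∈ Finset.range m, u i‖ ^ 2
      = (a - b) * ((m : ℝ)⁻¹ - (n : ℝ)⁻¹) := by
  have hm' : (m : ℝ) ≠ 0 := by positivity
  have hn' : (n : ℝ) ≠ 0 := by have := hm.trans_le hmn; positivity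
  have hc := inner_sum_range_of_constant_gram ha hb hmn
  rw [real_inner_comm] at hc
  rw [norm_sub_sq_real, ← real_inner_self_eq_norm_sq, ← real_inner_self_eq_norm_sq]
  simp only [inner_smul_left, inner_smul_right, inner_sum_range_of_constant_gram ha hb le_rfl,
    hc, conj_trivial]
  field_simp
  ring

lemma cauchySeq_average_of_constant_gram {u : ℕ → E} {a b : ℝ}
    (ha : ∀ i, inner ℝ (u i) (u i) = a) (hb : ∀ i j, i ≠ j → inner ℝ (u i) (u j) = b) :
    CauchySeq fun n : ℕ => (n : ℝ)⁻¹ • ∑ i ∈ Finset.range n, u i := by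
  refine Metric.cauchySeq_iff'.2 fun ε hε => ?_
  obtain ⟨m, hm⟩ := exists_nat_gt (|a - b| / ε ^ 2)
  have hm0 : 0 < (m : ℝ) := lt_of_le_of_lt (by positivity) hm
  refine ⟨m, fun n hn => ?_⟩
  rw [dist_eq_norm]
  refine lt_of_pow_lt_pow_left₀ 2 hε.le ?_
  rw [norm_sub_sq_average_of_constant_gram ha hb (by exact_mod_cast hm0) hn]
  have hmn : (m : ℝ) ≤ n := by exact_mod_cast hn
  calc (a - b) * ((m : ℝ)⁻¹ - (n : ℝ)⁻¹) ≤ |a - b| * (m : ℝ)⁻¹ := by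
        refine mul_le_mul (le_abs_self _) ?_ (sub_nonneg.2 ?_) (abs_nonneg _)
        · have : (0 : ℝ) ≤ (n : ℝ)⁻¹ := by positivity
          linarith
        · gcongr
    _ < ε ^ 2 := by
        rw [div_lt_iff₀ (by positivity)] at hm
        rw [← div_eq_mul_inv, div_lt_iff₀ hm0]
        linarith

end Hilbert

end ExchWLLN

namespace ExchWLLN

variable {Ω : Type*} [mΩ : MeasurableSpace Ω] {μ : Measure Ω} {g : ℕ → Ω → ℝ}

/-! ### The conditional law of the terms given the tail -/

instance [IsFiniteMeasure μ] (ω : Ω) : IsProbabilityMeasure (tailLaw μ g ω) := by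
  unfold tailLaw; infer_instance

lemma measurable_integral_tailLaw {E : Type*} [NormedAddCommGroup E] [NormedSpace ℝ E]
    [MeasurableSpace E] [BorelSpace E] [IsFiniteMeasure μ] {f : ℝ → E}
    (hf : StronglyMeasurable f) :
    Measurable[tail g] fun ω => ∫ x, f x ∂(tailLaw μ g ω) :=
  (StronglyMeasurable.integral_kernel (κ := tailLaw μ g) hf).measurable

lemma norm_integral_tailLaw_le {E : Type*} [NormedAddCommGroup E] [NormedSpace ℝ E]
    [IsFiniteMeasure μ] {f : ℝ → E} {C : ℝ} (hC : ∀ x, ‖f x‖ ≤ C) (ω : Ω) :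
    ‖∫ x, f x ∂(tailLaw μ g ω)‖ ≤ C := by
  simpa using norm_integral_le_of_norm_le_const (μ := tailLaw μ g ω) (Eventually.of_forall hC)

/-- Supplies the off-diagonal entry of the Gram matrix. Each swap moves one index and fixes the
other; the pair is brought to (0, 1) by way of 0 and commutativity. -/
lemma Exchangeable.integral_mul_eq [IsFiniteMeasure μ] (hex : Exchangeable μ g)
    (hg : ∀ n, Measurable (g n)) {f : ℝ → ℝ} (hf : Measurable f) {i j : ℕ} (hij : i ≠ j) :
    ∫ ω, f (g i ω) * f (g j ω) ∂μ = ∫ ω, f (g 0 ω) * f (g 1 ω) ∂μ := by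
  have step : ∀ i j k : ℕ, i ≠ j → i ≠ k →
      ∫ ω, f (g i ω) * f (g j ω) ∂μ = ∫ ω, f (g i ω) * f (g k ω) ∂μ := fun i j k hj hk => by
    have hH : Measurable fun x : ℕ → ℝ => f (x i) * f (x k) := by fun_prop
    have h := hex.integral_comp_swap hg j k hH.stronglyMeasurable
    simpa only [Equiv.swap_apply_of_ne_of_ne hj hk, Equiv.swap_apply_right] using h
  have comm : ∀ i j : ℕ, ∫ ω, f (g i ω) * f (g j ω) ∂μ = ∫ ω, f (g j ω) * f (g i ω) ∂μ :=
    fun i j => by simp only [mul_comm]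
  have zero : ∀ j, j ≠ 0 →
      ∫ ω, f (g 0 ω) * f (g j ω) ∂μ = ∫ ω, f (g 0 ω) * f (g 1 ω) ∂μ :=
    fun j hj => step 0 j 1 hj.symm zero_ne_one
  by_cases hi : i = 0
  · subst hi; exact zero j hij.symm
  · by_cases hj : j = 0
    · subst hj; rw [comm]; exact zero i hi
    · rw [step i j 0 hij hi, comm, zero i hi]

lemma Exchangeable.integral_comp_eq [IsFiniteMeasure μ] (hex : Exchangeable μ g)
    (hg : ∀ n, Measurable (g n)) {f : ℝ → ℝ} (hf : Measurable f) (i : ℕ) :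
    ∫ ω, f (g i ω) ∂μ = ∫ ω, f (g 0 ω) ∂μ := by
  have hH : Measurable fun x : ℕ → ℝ => f (x 0) := by fun_prop
  have h := hex.integral_comp_swap hg i 0 hH.stronglyMeasurable
  simpa only [Equiv.swap_apply_right] using h

/-- The limit of the averages along a subsequence is tail-measurable. -/
lemma measurable_limUnder_average {Ω : Type*} (g : ℕ → Ω → ℝ) {f : ℝ → ℝ} (hf : Measurable f)
    {ns : ℕ → ℕ} (hns : Tendsto ns atTop atTop) :
    Measurable[tail g] fun ω => limUnder atTop fun j : ℕ =>
      ((ns j : ℕ) : ℝ)⁻¹ * ∑ k ∈ Finset.range (ns j), f (g k ω) := by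
  rw [measurable_iff_comap_le, tail]
  refine le_iInf fun m => ?_
  rw [← measurable_iff_comap_le]
  let _ : MeasurableSpace Ω := ⨆ k : ℕ, ⨆ _ : m ≤ k, MeasurableSpace.comap (g k) inferInstance
  -- The first m terms are negligible after division by `ns j`, so the limit can be computed from
  -- the terms of index at least m alone.
  have e : (fun ω => limUnder atTop fun j : ℕ =>
      ((ns j : ℕ) : ℝ)⁻¹ * ∑ k ∈ Finset.range (ns j), f (g k ω)) =
      fun ω => limUnder atTop fun j : ℕ =>
        ((ns j : ℕ) : ℝ)⁻¹ * ∑ k ∈ Finset.Ico m (ns j), f (g k ω) := by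
    funext ω
    have hd : Tendsto (fun j => ((ns j : ℕ) : ℝ)⁻¹ * ∑ k ∈ Finset.range (ns j), f (g k ω)
        - ((ns j : ℕ) : ℝ)⁻¹ * ∑ k ∈ Finset.Ico m (ns j), f (g k ω)) atTop (𝓝 0) := by
      have h0 : Tendsto (fun j => ((ns j : ℕ) : ℝ)⁻¹ * ∑ k ∈ Finset.range m, f (g k ω))
          atTop (𝓝 (0 * ∑ k ∈ Finset.range m, f (g k ω))) :=
        ((tendsto_inv_atTop_nhds_zero_nat (𝕜 := ℝ)).comp hns).mul_const _
      rw [zero_mul] at h0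
      refine h0.congr' ?_
      filter_upwards [hns.eventually_ge_atTop m] with j hj
      rw [← Finset.sum_range_add_sum_Ico _ hj]
      ring
    have hiff : ∀ x : ℝ, Tendsto (fun j => ((ns j : ℕ) : ℝ)⁻¹ *
        ∑ k ∈ Finset.range (ns j), f (g k ω)) atTop (𝓝 x) ↔
        Tendsto (fun j => ((ns j : ℕ) : ℝ)⁻¹ *
          ∑ k ∈ Finset.Ico m (ns j), f (g k ω)) atTop (𝓝 x) := fun x =>
      ⟨fun h => by simpa using h.sub hd, fun h => by simpa using hd.add h⟩
    -- The equality also holds where the averages diverge: `lim` is a choice that depends only on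
    -- the set of limit points x, and the two sets agree.
    unfold limUnder lim
    congr 1
    funext x
    exact propext (hiff x)
  rw [e]
  refine (StronglyMeasurable.limUnder fun j => Measurable.stronglyMeasurable ?_).measurable
  refine Measurable.const_mul (Finset.measurable_sum _ fun k hk => hf.comp ?_) _
  rw [measurable_iff_comap_le]
  exact le_iSup₂_of_le k (Finset.mem_Ico.1 hk).1 le_rfl

/-! ### De Finetti's theorem -/

section Averages

variable [IsProbabilityMeasure μ]

/-- The averages converge in the mean to a tail-measurable limit. -/
lemma Exchangeable.exists_tendsto_average (hex : Exchangeable μ g)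
    (hg : ∀ n, Measurable (g n)) {f : ℝ → ℝ} (hf : Measurable f) {C : ℝ} (hC : ∀ x, |f x| ≤ C) :
    ∃ L : Ω → ℝ, Measurable[tail g] L ∧ Integrable L μ ∧
      Tendsto (fun n : ℕ => ∫ ω, |(n : ℝ)⁻¹ * ∑ k ∈ Finset.range n, f (g k ω) - L ω| ∂μ)
        atTop (𝓝 0) := by
  have hX : ∀ k, MemLp (fun ω => f (g k ω)) 2 μ := fun k =>
    MemLp.of_bound (hf.comp (hg k)).aestronglyMeasurable C (Eventually.of_forall fun ω => hC _)
  set u : ℕ → Lp ℝ 2 μ := fun k => (hX k).toLp _ with hu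
  have hinner : ∀ i j, inner ℝ (u i) (u j) = ∫ ω, f (g i ω) * f (g j ω) ∂μ := fun i j => by
    rw [L2.inner_def]
    refine integral_congr_ae ?_
    filter_upwards [(hX i).coeFn_toLp, (hX j).coeFn_toLp] with ω h1 h2
    rw [hu]
    simp only [h1, h2]
    simp [mul_comm]
  obtain ⟨ℓ, hℓ⟩ := cauchySeq_tendsto_of_complete (cauchySeq_average_of_constant_gram (u := u)
    (a := ∫ ω, f (g 0 ω) * f (g 0 ω) ∂μ) (b := ∫ ω, f (g 0 ω) * f (g 1 ω) ∂μ)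
    (fun i => by
      rw [hinner]
      exact hex.integral_comp_eq hg (f := fun x => f x * f x) (by fun_prop) i)
    (fun i j hij => by rw [hinner]; exact hex.integral_mul_eq hg hf hij))
  have hcoe : ∀ n : ℕ, ((n : ℝ)⁻¹ • ∑ i ∈ Finset.range n, u i : Lp ℝ 2 μ) =ᵐ[μ]
      fun ω => (n : ℝ)⁻¹ * ∑ k ∈ Finset.range n, f (g k ω) := fun n => by
    have h1 : ∀ᵐ ω ∂μ, ∀ i, u i ω = f (g i ω) := ae_all_iff.2 fun i => (hX i).coeFn_toLp
    filter_upwards [Lp.coeFn_smul (n : ℝ)⁻¹ (∑ i ∈ Finset.range n, u i),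
      Lp.coeFn_finsetSum (Finset.range n) u, h1] with ω h2 h3 h4
    rw [h2, Pi.smul_apply, h3]
    simp [h4]
  have hmeas : TendstoInMeasure μ
      (fun (n : ℕ) ω => (n : ℝ)⁻¹ * ∑ k ∈ Finset.range n, f (g k ω)) atTop ℓ :=
    (tendstoInMeasure_of_tendsto_Lp hℓ).congr_left hcoe
  -- The L² limit is only a class for the ambient σ-algebra; the pointwise limit along an a.e.
  -- convergent subsequence provides a tail-measurable version.
  obtain ⟨ns, hns, hae⟩ := hmeas.exists_seq_tendsto_ae
  have hLℓ : (fun ω => limUnder atTop fun j : ℕ =>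
      ((ns j : ℕ) : ℝ)⁻¹ * ∑ k ∈ Finset.range (ns j), f (g k ω)) =ᵐ[μ] ℓ := by
    filter_upwards [hae] with ω hω using hω.limUnder_eq
  refine ⟨_, measurable_limUnder_average g hf hns.tendsto_atTop,
    ((Lp.memLp ℓ).integrable (by norm_num)).congr hLℓ.symm, ?_⟩
  rw [tendsto_iff_norm_sub_tendsto_zero] at hℓ
  refine squeeze_zero (fun n => integral_nonneg fun ω => abs_nonneg _) (fun n => ?_) hℓ
  set v : Lp ℝ 2 μ := (n : ℝ)⁻¹ • ∑ i ∈ Finset.range n, u i - ℓ with hv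
  calc ∫ ω, |(n : ℝ)⁻¹ * ∑ k ∈ Finset.range n, f (g k ω) - _| ∂μ = ∫ ω, ‖v ω‖ ∂μ := by
        refine integral_congr_ae ?_
        filter_upwards [hcoe n, hLℓ, Lp.coeFn_sub ((n : ℝ)⁻¹ • ∑ i ∈ Finset.range n, u i) ℓ]
          with ω h1 h2 h3
        rw [h2, hv, h3, Pi.sub_apply, h1, Real.norm_eq_abs]
    _ = (eLpNorm v 1 μ).toReal := by
        rw [integral_norm_eq_lintegral_enorm (Lp.aestronglyMeasurable v),
          eLpNorm_one_eq_lintegral_enorm]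
    _ ≤ (eLpNorm v 2 μ).toReal :=
        ENNReal.toReal_mono (Lp.eLpNorm_ne_top v)
          (eLpNorm_le_eLpNorm_of_exponent_le (by norm_num) (Lp.aestronglyMeasurable v))
    _ = ‖v‖ := (Lp.norm_def v).symm

lemma Exchangeable.setIntegral_comp_eq (hex : Exchangeable μ g)
    (hg : ∀ n, Measurable (g n)) {f : ℝ → ℝ} (hf : Measurable f) {B : Set Ω}
    (hB : MeasurableSet[tail g] B) (k : ℕ) :
    ∫ ω in B, f (g k ω) ∂μ = ∫ ω in B, f (g 0 ω) ∂μ := by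
  have hW : Measurable[tail g] (B.indicator fun _ => (1 : ℂ)) :=
    (@measurable_const _ _ _ (tail g) (1 : ℂ)).indicator hB
  have h := hex.integral_tail_mul_prod_mul hg hW ∅ (f := fun _ _ => 1)
    (fun _ => measurable_const) (φ := fun x => (f x : ℂ)) (by fun_prop) (a := k) (k := 0)
    (by simp) (by simp)
  have e : ∀ j, ∫ ω, (B.indicator fun _ => (1 : ℂ)) ω * (∏ i ∈ (∅ : Finset ℕ), 1) *
      (f (g j ω) : ℂ) ∂μ = ((∫ ω in B, f (g j ω) ∂μ : ℝ) : ℂ) := fun j => by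
    rw [← integral_indicator (tail_le hg B hB), ← integral_complex_ofReal]
    congr 1
    funext ω
    by_cases hω : ω ∈ B <;> simp [hω]
  rw [e, e] at h
  exact_mod_cast h

/-- The averages of a bounded function of the terms converge in the mean to the tail-conditional
expectation. -/
lemma Exchangeable.tendsto_average (hex : Exchangeable μ g)
    (hg : ∀ n, Measurable (g n)) {f : ℝ → ℝ} (hf : Measurable f) {C : ℝ} (hC : ∀ x, |f x| ≤ C) :
    Tendsto (fun n : ℕ => ∫ ω, |(n : ℝ)⁻¹ * ∑ k ∈ Finset.range n, f (g k ω)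
      - ∫ x, f x ∂(tailLaw μ g ω)| ∂μ) atTop (𝓝 0) := by
  obtain ⟨L, hLm, hLi, hL⟩ := hex.exists_tendsto_average hg hf hC
  have hi : ∀ k, Integrable (fun ω => f (g k ω)) μ := fun k =>
    Integrable.of_bound (hf.comp (hg k)).aestronglyMeasurable C (Eventually.of_forall fun ω => hC _)
  have hA : ∀ n : ℕ, Integrable (fun ω => (n : ℝ)⁻¹ * ∑ k ∈ Finset.range n, f (g k ω)) μ :=
    fun n => (integrable_finsetSum _ fun k _ => hi k).const_mul _
  -- On a tail event every term has the same integral, hence so have the averages (for n > 0) and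
  -- their L¹ limit. This characterizes the conditional expectation.
  have key : L =ᵐ[μ] μ[fun ω => f (g 0 ω) | tail g] := by
    refine ae_eq_condExp_of_forall_setIntegral_eq (tail_le hg) (hi 0)
      (fun s _ _ => hLi.integrableOn) (fun B hB _ => ?_)
      (hLm.stronglyMeasurable.aestronglyMeasurable)
    have h1 : Tendsto (fun n : ℕ => ∫ ω in B, (n : ℝ)⁻¹ * ∑ k ∈ Finset.range n, f (g k ω) ∂μ)
        atTop (𝓝 (∫ ω in B, L ω ∂μ)) := by
      rw [tendsto_iff_norm_sub_tendsto_zero]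
      refine squeeze_zero (fun n => norm_nonneg _) (fun n => ?_) hL
      rw [← integral_sub (hA n).integrableOn hLi.integrableOn]
      refine (norm_integral_le_integral_norm _).trans ?_
      exact setIntegral_le_integral ((hA n).sub hLi).norm
        (Eventually.of_forall fun ω => norm_nonneg _)
    refine tendsto_nhds_unique h1 (tendsto_const_nhds.congr' ?_)
    filter_upwards [eventually_gt_atTop 0] with n hn
    rw [integral_const_mul, integral_finsetSum _ fun k _ => (hi k).integrableOn]
    simp only [hex.setIntegral_comp_eq hg hf hB]
    have : (n : ℝ) ≠ 0 := by positivity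
    simp [this]
  refine hL.congr fun n => integral_congr_ae ?_
  filter_upwards [key.trans (condExp_ae_eq_tailLaw μ hg hf (hi 0))] with ω hω
  rw [hω]

lemma Exchangeable.tendsto_average_complex (hex : Exchangeable μ g)
    (hg : ∀ n, Measurable (g n)) {f : ℝ → ℂ} (hf : Measurable f) {C : ℝ} (hC : ∀ x, ‖f x‖ ≤ C) :
    Tendsto (fun n : ℕ => ∫ ω, ‖(n : ℝ)⁻¹ • ∑ k ∈ Finset.range n, f (g k ω)
      - ∫ x, f x ∂(tailLaw μ g ω)‖ ∂μ) atTop (𝓝 0) := by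
  have hre := hex.tendsto_average hg (f := fun x => (f x).re) (by fun_prop)
    (fun x => (Complex.abs_re_le_norm _).trans (hC x))
  have him := hex.tendsto_average hg (f := fun x => (f x).im) (by fun_prop)
    (fun x => (Complex.abs_im_le_norm _).trans (hC x))
  have hadd := hre.add him
  rw [add_zero] at hadd
  have hInt : ∀ (ψ : ℝ → ℝ), Measurable ψ → (∀ x, |ψ x| ≤ C) → ∀ n : ℕ,
      Integrable (fun ω => |(n : ℝ)⁻¹ * ∑ k ∈ Finset.range n, ψ (g k ω)
        - ∫ x, ψ x ∂(tailLaw μ g ω)|) μ := fun ψ hψ hb n => by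
    refine Integrable.abs (Integrable.sub (Integrable.const_mul
      (integrable_finsetSum _ fun k _ => ?_) _) ?_)
    · exact Integrable.of_bound (hψ.comp (hg k)).aestronglyMeasurable C
        (Eventually.of_forall fun ω => hb _)
    · exact Integrable.of_bound ((measurable_integral_tailLaw hψ.stronglyMeasurable).mono
        (tail_le hg) le_rfl).aestronglyMeasurable C
        (Eventually.of_forall fun ω => norm_integral_tailLaw_le hb ω)
  refine squeeze_zero (fun n => integral_nonneg fun ω => norm_nonneg _) (fun n => ?_) hadd
  have h1 := hInt (fun x => (f x).re) (by fun_prop)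
    (fun x => (Complex.abs_re_le_norm _).trans (hC x)) n
  have h2 := hInt (fun x => (f x).im) (by fun_prop)
    (fun x => (Complex.abs_im_le_norm _).trans (hC x)) n
  rw [← integral_add h1 h2]
  refine integral_mono_of_nonneg (Eventually.of_forall fun ω => norm_nonneg _) (h1.add h2)
    (Eventually.of_forall fun ω => ?_)
  have hfi : Integrable f (tailLaw μ g ω) :=
    Integrable.of_bound hf.aestronglyMeasurable C (Eventually.of_forall hC)
  have ere : ∫ x, (f x).re ∂(tailLaw μ g ω) = (∫ x, f x ∂(tailLaw μ g ω)).re :=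
    integral_re hfi
  have eim : ∫ x, (f x).im ∂(tailLaw μ g ω) = (∫ x, f x ∂(tailLaw μ g ω)).im :=
    integral_im hfi
  refine (Complex.norm_le_abs_re_add_abs_im _).trans (le_of_eq ?_)
  simp only [ere, eim, Complex.sub_re, Complex.sub_im, Complex.real_smul, Complex.re_ofReal_mul,
    Complex.im_ofReal_mul, Complex.re_sum, Complex.im_sum]

/-- The terms are conditionally independent given the tail, with common law `tailLaw`. -/
theorem Exchangeable.integral_tail_mul_prod (hex : Exchangeable μ g)
    (hg : ∀ n, Measurable (g n)) {f : ℕ → ℝ → ℂ} (hf : ∀ i, Measurable (f i)) {C : ℝ}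
    (hC : ∀ i x, ‖f i x‖ ≤ C) (s : Finset ℕ) {W : Ω → ℂ} (hW : Measurable[tail g] W) {K : ℝ}
    (hK : ∀ ω, ‖W ω‖ ≤ K) :
    ∫ ω, W ω * ∏ i ∈ s, f i (g i ω) ∂μ
      = ∫ ω, W ω * ∏ i ∈ s, ∫ x, f i x ∂(tailLaw μ g ω) ∂μ := by
  induction s using Finset.induction_on generalizing W K with
  | empty => simp
  | insert a s ha ih =>
    have hC0 : 0 ≤ C := (norm_nonneg _).trans (hC 0 0)
    have hK0 : ∀ ω : Ω, 0 ≤ K := fun ω => (norm_nonneg _).trans (hK ω)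
    have hLm := measurable_integral_tailLaw (μ := μ) (g := g) (hf a).stronglyMeasurable
    have hW' : Measurable W := hW.mono (tail_le hg) le_rfl
    have hL' := hLm.mono (tail_le hg) le_rfl
    have hΦm : Measurable fun ω => W ω * ∏ i ∈ s, f i (g i ω) :=
      hW'.mul (Finset.measurable_prod _ fun i _ => (hf i).comp (hg i))
    have hΦb : ∀ ω, ‖W ω * ∏ i ∈ s, f i (g i ω)‖ ≤ K * C ^ s.card := fun ω => by
      rw [norm_mul, norm_prod]
      refine mul_le_mul (hK ω) ?_ (Finset.prod_nonneg fun i _ => norm_nonneg _) (hK0 ω)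
      exact (Finset.prod_le_prod (fun i _ => norm_nonneg _) fun i _ => hC i _).trans (by simp)
    have hbdd : ∀ {h : Ω → ℂ} {c : ℝ}, Measurable h → (∀ ω, ‖h ω‖ ≤ c) → Integrable h μ :=
      fun hm hb => Integrable.of_bound hm.aestronglyMeasurable _ (Eventually.of_forall hb)
    have hterm : ∀ k, Integrable
        (fun ω => W ω * (∏ i ∈ s, f i (g i ω)) * f a (g k ω)) μ := fun k => by
      refine (hbdd hΦm hΦb).mul_bdd ((hf a).comp (hg k)).aestronglyMeasurable
        (Eventually.of_forall fun ω => hC a _)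
    have hlim : Integrable
        (fun ω => W ω * (∏ i ∈ s, f i (g i ω)) * ∫ x, f a x ∂(tailLaw μ g ω)) μ :=
      (hbdd hΦm hΦb).mul_bdd hL'.aestronglyMeasurable
        (Eventually.of_forall fun ω => norm_integral_tailLaw_le (hC a) ω)
    -- By exchangeability `g a` may be replaced by `g k` for every k beyond s. The finitely many
    -- smaller k do not affect the Cesàro means, whose limit can also be computed with the averages
    -- of `f a (g k)`.
    have hconst : Tendsto
        (fun k => ∫ ω, W ω * (∏ i ∈ s, f i (g i ω)) * f a (g k ω) ∂μ) atTop
        (𝓝 (∫ ω, W ω * (∏ i ∈ s, f i (g i ω)) * f a (g a ω) ∂μ)) := by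
      refine tendsto_const_nhds.congr' ?_
      filter_upwards [eventually_gt_atTop (s.sup id)] with k hk
      refine hex.integral_tail_mul_prod_mul hg hW s hf (hf a) ha fun hks => ?_
      have := Finset.le_sup (f := id) hks
      simp only [id] at this
      omega
    have hces := hconst.cesaro_smul
    have hconv : Tendsto (fun n : ℕ => (n⁻¹ : ℝ) • ∑ k ∈ Finset.range n,
        ∫ ω, W ω * (∏ i ∈ s, f i (g i ω)) * f a (g k ω) ∂μ) atTop
        (𝓝 (∫ ω, W ω * (∏ i ∈ s, f i (g i ω)) * ∫ x, f a x ∂(tailLaw μ g ω) ∂μ)) := by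
      rw [tendsto_iff_norm_sub_tendsto_zero]
      have h0 := (hex.tendsto_average_complex hg (hf a) (hC a)).const_mul (K * C ^ s.card)
      rw [mul_zero] at h0
      refine squeeze_zero (fun n => norm_nonneg _) (fun n => ?_) h0
      rw [← integral_finsetSum _ fun k _ => hterm k, ← integral_smul,
        ← integral_sub (Integrable.fun_smul _ (integrable_finsetSum _ fun k _ => hterm k)) hlim,
        ← integral_const_mul]
      refine norm_integral_le_of_norm_le (Integrable.const_mul (Integrable.norm ?_) _)
        (Eventually.of_forall fun ω => ?_)
      · refine Integrable.sub (Integrable.fun_smul _ (integrable_finsetSum _ fun k _ => ?_)) ?_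
        · exact hbdd ((hf a).comp (hg k)) fun ω => hC a _
        · exact hbdd hL' fun ω => norm_integral_tailLaw_le (hC a) ω
      · rw [← Finset.mul_sum, ← mul_smul_comm, ← mul_sub, norm_mul]
        exact mul_le_mul_of_nonneg_right (hΦb ω) (norm_nonneg _)
    have heq := tendsto_nhds_unique hces hconv
    -- The new factor is tail-measurable and joins the weight; this is why the induction is over all
    -- W.
    have hWL : Measurable[tail g] fun ω => W ω * ∫ x, f a x ∂(tailLaw μ g ω) := hW.mul hLm
    have hih := ih hWL (K := K * C) fun ω => by
      rw [norm_mul]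
      exact mul_le_mul (hK ω) (norm_integral_tailLaw_le (hC a) ω) (norm_nonneg _) (hK0 ω)
    calc ∫ ω, W ω * ∏ i ∈ insert a s, f i (g i ω) ∂μ
        = ∫ ω, W ω * (∏ i ∈ s, f i (g i ω)) * f a (g a ω) ∂μ := by
          simp only [Finset.prod_insert ha]
          congr 1; funext ω; ring
      _ = ∫ ω, (W ω * ∫ x, f a x ∂(tailLaw μ g ω)) * ∏ i ∈ s, f i (g i ω) ∂μ := by
          rw [heq]
          congr 1; funext ω; ring
      _ = _ := by
          rw [hih]
          simp only [Finset.prod_insert ha]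
          congr 1; funext ω; ring

end Averages

end ExchWLLN

namespace ExchWLLN

/-! ### Truncated moments of a fixed law -/

section FixedLaw

variable (ν : Measure ℝ) [IsProbabilityMeasure ν]

lemma measurableSet_abs_le (c : ℝ) : MeasurableSet {x : ℝ | |x| ≤ c} :=
  measurableSet_le measurable_norm measurable_const

lemma measurableSet_lt_abs (c : ℝ) : MeasurableSet {x : ℝ | c < |x|} :=
  measurableSet_lt measurable_const measurable_norm

lemma trunc_sq (c x : ℝ) : trunc c x ^ 2 = {y : ℝ | |y| ≤ c}.indicator (fun y => y ^ 2) x := by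
  by_cases h : |x| ≤ c <;> simp [trunc, Set.indicator, h]

lemma integrable_indicator_sq (c : ℝ) :
    Integrable ({y : ℝ | |y| ≤ c}.indicator fun y => y ^ 2) ν := by
  have h := (memLp_trunc ν measurable_id c 2).integrable_sq
  simpa only [id, trunc_sq] using h

lemma memLp_trunc_two (c : ℝ) : MemLp (trunc c) 2 ν :=
  memLp_trunc ν measurable_id c 2

lemma integrable_trunc (c : ℝ) : Integrable (trunc c) ν :=
  (memLp_trunc ν measurable_id c 1).integrable le_rfl

lemma integrable_min_sq {c : ℝ} (hc : 0 ≤ c) : Integrable (fun x : ℝ => (min |x| c) ^ 2) ν := by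
  refine Integrable.of_bound (by fun_prop) (c ^ 2) (Eventually.of_forall fun x => ?_)
  have : 0 ≤ min |x| c := le_min (abs_nonneg _) hc
  rw [Real.norm_eq_abs, abs_of_nonneg (by positivity)]
  gcongr
  exact min_le_right _ _

lemma integral_min_sq (c : ℝ) :
    ∫ x, (min |x| c) ^ 2 ∂ν =
      ∫ x, {y : ℝ | |y| ≤ c}.indicator (fun y => y ^ 2) x ∂ν + c ^ 2 * ν.real {x | c < |x|} := by
  have e : ∀ x : ℝ, (min |x| c) ^ 2 = {y : ℝ | |y| ≤ c}.indicator (fun y => y ^ 2) x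
      + {y : ℝ | c < |y|}.indicator (fun _ => c ^ 2) x := fun x => by
    rcases le_or_gt |x| c with h | h
    · simp [Set.indicator, h, h.not_gt]
    · simp [Set.indicator, h, h.not_ge, h.le]
  simp only [e]
  rw [integral_add (integrable_indicator_sq ν c)
    ((integrable_const _).indicator (measurableSet_lt_abs c)),
    integral_indicator_const _ (measurableSet_lt_abs c), smul_eq_mul, mul_comm (c ^ 2)]

lemma setIntegral_Ioc_indicator_Iio {M a : ℝ} (hM : 0 ≤ M) (ha : 0 ≤ a) :
    ∫ t in Set.Ioc 0 M, (Set.Iio a).indicator (fun t => t) t = (min M a) ^ 2 / 2 := by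
  rw [setIntegral_indicator measurableSet_Iio]
  have h : (Set.Ioc 0 M ∩ Set.Iio a : Set ℝ) =ᵐ[volume] Set.Ioc 0 (min M a) := by
    rw [← Set.Ioc_inter_Iic]
    exact (ae_eq_refl _).inter Iio_ae_eq_Iic
  rw [setIntegral_congr_set h, ← intervalIntegral.integral_of_le (le_min hM ha), integral_id]
  ring

/-- Fubini: for fixed x, t runs up to min(M, |x|/ε), and the integral of t is half the square of
that endpoint. -/
lemma integral_mul_measure_lt {ε M : ℝ} (hε : 0 < ε) (hM : 0 < M) :
    ∫ t in Set.Ioc 0 M, t * ν.real {x : ℝ | ε * t < |x|}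
      = (1 / (2 * ε ^ 2)) * ∫ x, (min |x| (ε * M)) ^ 2 ∂ν := by
  have hS : MeasurableSet {p : ℝ × ℝ | ε * p.1 < |p.2|} :=
    measurableSet_lt (by fun_prop) (by fun_prop)
  have hF : Integrable (Function.uncurry fun t x : ℝ =>
      {p : ℝ × ℝ | ε * p.1 < |p.2|}.indicator (fun p => p.1) (t, x))
      ((volume.restrict (Set.Ioc 0 M)).prod ν) := by
    have hm : Measurable (Function.uncurry fun t x : ℝ =>
      {p : ℝ × ℝ | ε * p.1 < |p.2|}.indicator (fun p => p.1) (t, x)) :=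
      measurable_fst.indicator hS
    refine Integrable.of_bound hm.aestronglyMeasurable M ?_
    have h1 : ∀ᵐ t ∂(volume.restrict (Set.Ioc 0 M)), t ∈ Set.Ioc (0 : ℝ) M :=
      ae_restrict_mem measurableSet_Ioc
    filter_upwards [Measure.quasiMeasurePreserving_fst.ae h1] with p hp
    simp only [Function.uncurry, Set.indicator]
    split_ifs
    · rw [Real.norm_eq_abs, abs_of_pos hp.1]; exact hp.2
    · simpa using hM.le
  calc ∫ t in Set.Ioc 0 M, t * ν.real {x : ℝ | ε * t < |x|}
      = ∫ t in Set.Ioc 0 M, ∫ x,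
          {p : ℝ × ℝ | ε * p.1 < |p.2|}.indicator (fun p => p.1) (t, x) ∂ν := by
        congr 1
        funext t
        have e : (fun x => {p : ℝ × ℝ | ε * p.1 < |p.2|}.indicator (fun p => p.1) (t, x)) =
            {x : ℝ | ε * t < |x|}.indicator fun _ => t := by
          funext x; simp [Set.indicator]
        rw [e, integral_indicator_const _ (measurableSet_lt_abs _), smul_eq_mul, mul_comm]
    _ = ∫ x, (∫ t in Set.Ioc 0 M,
          {p : ℝ × ℝ | ε * p.1 < |p.2|}.indicator (fun p => p.1) (t, x)) ∂ν :=
        integral_integral_swap hF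
    _ = ∫ x, (1 / (2 * ε ^ 2)) * (min |x| (ε * M)) ^ 2 ∂ν := by
        congr 1
        funext x
        have e : (fun t => {p : ℝ × ℝ | ε * p.1 < |p.2|}.indicator (fun p => p.1) (t, x)) =
            (Set.Iio (|x| / ε)).indicator fun t => t := by
          funext t; simp [Set.indicator, lt_div_iff₀ hε, mul_comm]
        rw [e, setIntegral_Ioc_indicator_Iio hM.le (by positivity)]
        have : min |x| (ε * M) = ε * min M (|x| / ε) := by
          rw [mul_min_of_nonneg _ _ hε.le, mul_div_cancel₀ _ hε.ne', min_comm]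
        rw [this]
        field_simp
    _ = _ := integral_const_mul _ _

lemma integrableOn_Ioi_inv_cube {c : ℝ} (hc : 0 < c) :
    IntegrableOn (fun t : ℝ => 1 / t ^ 3) (Set.Ioi c) := by
  refine (integrableOn_Ioi_rpow_of_lt (a := -3) (by norm_num) hc).congr_fun (fun t ht => ?_)
    measurableSet_Ioi
  have : 0 < t := hc.trans ht
  simp only
  rw [Real.rpow_neg this.le, one_div]
  norm_cast

lemma integral_Ioi_inv_cube {c : ℝ} (hc : 0 < c) :
    ∫ t in Set.Ioi c, 1 / t ^ 3 = 1 / (2 * c ^ 2) := by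
  have h := integral_Ioi_rpow_of_lt (a := -3) (by norm_num) hc
  have e : ∫ t in Set.Ioi c, 1 / t ^ 3 = ∫ t in Set.Ioi c, t ^ (-3 : ℝ) := by
    refine setIntegral_congr_fun measurableSet_Ioi fun t ht => ?_
    have : 0 < t := hc.trans ht
    rw [Real.rpow_neg this.le, one_div]
    norm_cast
  have h3 : (-3 + 1 : ℝ) = -2 := by norm_num
  have h4 : c ^ (-2 : ℝ) = (c ^ 2)⁻¹ := by
    rw [Real.rpow_neg hc.le]
    norm_cast
  rw [e, h, h3, h4]
  field_simp

lemma setIntegral_Ioi_indicator_Ici {M a : ℝ} (hM : 0 < M) :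
    ∫ t in Set.Ioi M, (Set.Ici a).indicator (fun t => 1 / t ^ 3) t = 1 / (2 * (max M a) ^ 2) := by
  rw [setIntegral_indicator measurableSet_Ici]
  have h : (Set.Ioi M ∩ Set.Ici a : Set ℝ) =ᵐ[volume] Set.Ioi (max M a) := by
    rw [← Set.Ioi_inter_Ioi]
    exact (ae_eq_refl _).inter Ioi_ae_eq_Ici.symm
  rw [setIntegral_congr_set h, integral_Ioi_inv_cube (lt_max_of_lt_left hM)]

/-- For fixed x, t runs over t > max(M, |x|/ε), and x²/(2 max(M, |x|/ε)²) is the truncated square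
divided by 2M². The integrand is nonnegative there, so this value also yields integrability on the
product. -/
lemma integrable_indicator_div_cube {ε M : ℝ} (hε : 0 < ε) (hM : 0 < M) :
    Integrable (Function.uncurry fun x t : ℝ =>
      {p : ℝ × ℝ | |p.1| ≤ ε * p.2}.indicator (fun p => p.1 ^ 2 * (1 / p.2 ^ 3)) (x, t))
      (ν.prod (volume.restrict (Set.Ioi M))) ∧
    ∀ x : ℝ, ∫ t in Set.Ioi M,
      {p : ℝ × ℝ | |p.1| ≤ ε * p.2}.indicator (fun p => p.1 ^ 2 * (1 / p.2 ^ 3)) (x, t)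
        = 1 / (2 * M ^ 2) * (min |x| (ε * M)) ^ 2 := by
  have hS : MeasurableSet {p : ℝ × ℝ | |p.1| ≤ ε * p.2} :=
    measurableSet_le (by fun_prop) (by fun_prop)
  have hm : Measurable (Function.uncurry fun x t : ℝ =>
      {p : ℝ × ℝ | |p.1| ≤ ε * p.2}.indicator (fun p => p.1 ^ 2 * (1 / p.2 ^ 3)) (x, t)) :=
    Measurable.indicator (by fun_prop) hS
  have e : ∀ x : ℝ, (fun t => {p : ℝ × ℝ | |p.1| ≤ ε * p.2}.indicator
      (fun p => p.1 ^ 2 * (1 / p.2 ^ 3)) (x, t)) =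
      fun t => x ^ 2 * (Set.Ici (|x| / ε)).indicator (fun t => 1 / t ^ 3) t := fun x => by
    funext t
    simp [Set.indicator, div_le_iff₀ hε, mul_comm]
  have hval : ∀ x : ℝ, ∫ t in Set.Ioi M,
      {p : ℝ × ℝ | |p.1| ≤ ε * p.2}.indicator (fun p => p.1 ^ 2 * (1 / p.2 ^ 3)) (x, t)
        = 1 / (2 * M ^ 2) * (min |x| (ε * M)) ^ 2 := fun x => by
    rw [e, integral_const_mul, setIntegral_Ioi_indicator_Ici hM]
    rcases le_total |x| (ε * M) with h | h
    · rw [min_eq_left h, max_eq_left (by rwa [div_le_iff₀ hε, mul_comm]), sq_abs]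
      ring
    · have hx : 0 < |x| := (mul_pos hε hM).trans_le h
      rw [min_eq_right h, max_eq_right (by rwa [le_div_iff₀ hε, mul_comm]), ← sq_abs x]
      field_simp
  refine ⟨(integrable_prod_iff hm.aestronglyMeasurable).2
    ⟨Eventually.of_forall fun x => ?_, ?_⟩, hval⟩
  · have h := ((integrableOn_Ioi_inv_cube hM).indicator
      (measurableSet_Ici (a := |x| / ε))).const_mul (x ^ 2)
    rw [← e x] at h
    exact h
  · have h := (integrable_min_sq ν (mul_pos hε hM).le).const_mul (1 / (2 * M ^ 2))
    refine h.congr (Eventually.of_forall fun x => ?_)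
    simp only
    rw [← hval x]
    refine setIntegral_congr_fun measurableSet_Ioi fun t ht => ?_
    have ht : 0 < t := hM.trans ht
    simp only [Function.uncurry, Set.indicator]
    split_ifs
    · rw [Real.norm_eq_abs, abs_of_nonneg (by positivity)]
    · simp

lemma indicator_sq_div_eq (ν : Measure ℝ) (ε t : ℝ) :
    ∫ x, {p : ℝ × ℝ | |p.1| ≤ ε * p.2}.indicator (fun p => p.1 ^ 2 * (1 / p.2 ^ 3)) (x, t) ∂ν
      = ((1 / t) * ∫ x, {y : ℝ | |y| ≤ ε * t}.indicator (fun y => y ^ 2) x ∂ν) / t ^ 2 := by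
  have e : ∀ x : ℝ,
      {p : ℝ × ℝ | |p.1| ≤ ε * p.2}.indicator (fun p => p.1 ^ 2 * (1 / p.2 ^ 3)) (x, t)
      = {y : ℝ | |y| ≤ ε * t}.indicator (fun y => y ^ 2) x * (1 / t ^ 3) := fun x => by
    simp only [Set.indicator, Set.mem_ofPred_eq]
    split_ifs <;> simp
  simp only [e]
  rw [integral_mul_const]
  ring

lemma integrableOn_second {ε M : ℝ} (hε : 0 < ε) (hM : 0 < M) :
    IntegrableOn (fun t => ((1 / t) *
      ∫ x, {y : ℝ | |y| ≤ ε * t}.indicator (fun y => y ^ 2) x ∂ν) / t ^ 2) (Set.Ioi M) := by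
  have h := (integrable_indicator_div_cube ν hε hM).1.integral_prod_right
  refine h.congr (Eventually.of_forall fun t => indicator_sq_div_eq ν ε t)

lemma integral_second {ε M : ℝ} (hε : 0 < ε) (hM : 0 < M) :
    ∫ t in Set.Ioi M, ((1 / t) *
      ∫ x, {y : ℝ | |y| ≤ ε * t}.indicator (fun y => y ^ 2) x ∂ν) / t ^ 2
      = 1 / (2 * M ^ 2) * ∫ x, (min |x| (ε * M)) ^ 2 ∂ν := by
  obtain ⟨h1, h2⟩ := integrable_indicator_div_cube ν hε hM
  have h3 := integral_integral_swap h1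
  simp only [h2, indicator_sq_div_eq] at h3
  rw [← h3, integral_const_mul]

lemma variance_trunc_le (c : ℝ) :
    variance (trunc c) ν ≤ ∫ x, {y : ℝ | |y| ≤ c}.indicator (fun y => y ^ 2) x ∂ν := by
  refine (variance_le_expectation_sq (measurable_trunc c).aestronglyMeasurable).trans (le_of_eq ?_)
  refine integral_congr_ae (Eventually.of_forall fun x => ?_)
  exact trunc_sq c x

lemma sq_integral_trunc_le (c : ℝ) :
    (∫ x, trunc c x ∂ν) ^ 2 ≤ ∫ x, {y : ℝ | |y| ≤ c}.indicator (fun y => y ^ 2) x ∂ν := by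
  have h := variance_nonneg (trunc c) ν
  rw [variance_eq_sub (memLp_trunc_two ν c)] at h
  have e : ∫ x, {y : ℝ | |y| ≤ c}.indicator (fun y => y ^ 2) x ∂ν = ∫ x, (trunc c ^ 2) x ∂ν :=
    integral_congr_ae (Eventually.of_forall fun x => (trunc_sq c x).symm)
  rw [e]
  linarith

/-- The truncated second moment is controlled by the truncated variance, up to the square of a
quantile. -/
lemma second_le_variance_trunc (c : ℝ) {K : ℝ} (hK : 0 ≤ K) (hν : ν.real {x | K < |x|} ≤ 1 / 4) :
    ∫ x, {y : ℝ | |y| ≤ c}.indicator (fun y => y ^ 2) x ∂ν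
      ≤ 2 * variance (trunc c) ν + 4 * K ^ 2 := by
  have h2 : MemLp (trunc c) 2 ν := memLp_trunc ν measurable_id c 2
  have hsq := h2.integrable_sq
  have hS : ∫ x, {y : ℝ | |y| ≤ c}.indicator (fun y => y ^ 2) x ∂ν = ∫ x, trunc c x ^ 2 ∂ν := by
    simp only [trunc_sq]
  have hvar : variance (trunc c) ν = ∫ x, trunc c x ^ 2 ∂ν - (∫ x, trunc c x ∂ν) ^ 2 :=
    variance_eq_sub h2
  set S := ∫ x, trunc c x ^ 2 ∂ν with hSdef
  set m := ∫ x, trunc c x ∂ν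
  rw [hS, hvar]
  have hS0 : 0 ≤ S := integral_nonneg fun x => sq_nonneg _
  set q := ν.real {x | K < |x|}
  have hq0 : 0 ≤ q := measureReal_nonneg
  -- Where |x| ≤ K the truncation is at most K; elsewhere 2|y| ≤ a y² + 1/a, a form of
  -- Cauchy–Schwarz with a free parameter.
  have hm : ∀ a : ℝ, 0 < a → |m| ≤ K + (a * S + q / a) / 2 := fun a ha => by
    calc |m| ≤ ∫ x, |trunc c x| ∂ν := abs_integral_le_integral_abs
      _ ≤ ∫ x, (K + (a * trunc c x ^ 2 +
            {x : ℝ | K < |x|}.indicator (fun _ => 1 / a) x) / 2) ∂ν := by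
        refine integral_mono (integrable_trunc ν c).abs ?_ fun x => ?_
        · exact (integrable_const _).add (((hsq.const_mul a).add
            ((integrable_const _).indicator (measurableSet_lt_abs K))).div_const 2)
        · rcases le_or_gt |x| K with h | h
          · have h1 : |trunc c x| ≤ K := by
              by_cases hx : |x| ≤ c
              · simpa [trunc, Set.indicator, hx] using h
              · simpa [trunc, Set.indicator, hx] using hK
            have h2 : 0 ≤ a * trunc c x ^ 2 := by positivity
            simp only [Set.indicator, Set.mem_ofPred_eq, h.not_gt, if_false]
            linarith
          · simp only [Set.indicator, Set.mem_ofPred_eq, h, if_true]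
            have h3 : 2 * |trunc c x| ≤ a * trunc c x ^ 2 + 1 / a := by
              rw [← sq_abs (trunc c x)]
              have : a * |trunc c x| ^ 2 + 1 / a - 2 * |trunc c x|
                  = (a * |trunc c x| - 1) ^ 2 / a := by field_simp; ring
              have h4 : 0 ≤ (a * |trunc c x| - 1) ^ 2 / a := by positivity
              linarith
            linarith
      _ = K + (a * S + q / a) / 2 := by
        have hind : Integrable ({x : ℝ | K < |x|}.indicator fun _ => 1 / a) ν :=
          (integrable_const _).indicator (measurableSet_lt_abs K)
        have hadd : Integrable (fun x => (a * trunc c x ^ 2 +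
            {x : ℝ | K < |x|}.indicator (fun _ => 1 / a) x) / 2) ν :=
          ((hsq.const_mul a).add hind).div_const 2
        rw [integral_add (integrable_const _) hadd,
          integral_div, integral_add (hsq.const_mul a) hind, integral_const_mul,
          integral_indicator_const _ (measurableSet_lt_abs K)]
        simp [q, S, div_eq_mul_inv]
  -- optimizing over `a` gives `|m| ≤ K + √S / 2`
  have hm' : |m| ≤ K + √S / 2 := by
    -- The choice is a = 1/(2√S), with q ≤ 1/4; when S = 0, a tends to infinity instead.
    rcases hS0.eq_or_lt with h0 | hpos
    · have hm0 : |m| ≤ K := by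
        refine le_of_forall_pos_le_add fun δ hδ => ?_
        have h1 := hm (1 / δ) (by positivity)
        rw [← h0] at h1
        have : q / (1 / δ) ≤ δ := by
          rw [div_div_eq_mul_div, div_one]
          nlinarith
        simp only [mul_zero, zero_add] at h1
        linarith
      have := Real.sqrt_nonneg S
      linarith
    · have hs : 0 < √S := Real.sqrt_pos.2 hpos
      have h1 := hm (1 / (2 * √S)) (by positivity)
      have h2 : 1 / (2 * √S) * S = √S / 2 := by
        field_simp
        rw [Real.sq_sqrt hS0]
      have h3 : q / (1 / (2 * √S)) ≤ √S / 2 := by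
        rw [div_div_eq_mul_div, div_one]
        nlinarith
      linarith
  -- The squared mean thus absorbs at most half of S, up to 2K².
  have h5 : m ^ 2 ≤ 2 * K ^ 2 + S / 2 := by
    have h6 : m ^ 2 ≤ (K + √S / 2) ^ 2 := by
      rw [← sq_abs]; gcongr
    nlinarith [Real.sq_sqrt hS0, sq_nonneg (K - √S / 2)]
  linarith

lemma integrableOn_variance {ε M : ℝ} (hε : 0 < ε) (hM : 0 < M) :
    IntegrableOn (fun t => ((1 / t) * variance (trunc (ε * t)) ν) / t ^ 2) (Set.Ioi M) := by
  have hS := integrableOn_second ν hε hM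
  have htr : Measurable (Function.uncurry fun t x : ℝ => trunc (ε * t) x) := by
    have : (Function.uncurry fun t x : ℝ => trunc (ε * t) x) =
        {p : ℝ × ℝ | |p.2| ≤ ε * p.1}.indicator fun p => p.2 := by
      funext p; simp [Function.uncurry, trunc, Set.indicator]
    rw [this]
    exact measurable_snd.indicator (measurableSet_le (by fun_prop) (by fun_prop))
  have hm : StronglyMeasurable fun t : ℝ => ∫ x, trunc (ε * t) x ∂ν :=
    htr.stronglyMeasurable.integral_prod_right
  have e : (fun t => ((1 / t) * variance (trunc (ε * t)) ν) / t ^ 2) =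
      fun t => ((1 / t) * ∫ x, {y : ℝ | |y| ≤ ε * t}.indicator (fun y => y ^ 2) x ∂ν) / t ^ 2
        - ((1 / t) * (∫ x, trunc (ε * t) x ∂ν) ^ 2) / t ^ 2 := by
    funext t
    rw [variance_eq_sub (memLp_trunc_two ν (ε * t))]
    simp only [Pi.pow_apply, trunc_sq]
    ring
  refine Integrable.mono hS ?_ ?_
  · rw [e]
    refine hS.aestronglyMeasurable.sub (Measurable.aestronglyMeasurable ?_)
    have := hm.measurable
    fun_prop
  · filter_upwards [ae_restrict_mem measurableSet_Ioi] with t ht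
    have ht : 0 < t := hM.trans ht
    have hv := variance_nonneg (trunc (ε * t)) ν
    have hle := variance_trunc_le ν (ε * t)
    rw [Real.norm_eq_abs, abs_of_nonneg (by positivity)]
    refine le_trans ?_ (le_abs_self _)
    gcongr

end FixedLaw

end ExchWLLN

namespace ExchWLLN

/-! ### Truncated second moments from characteristic functions -/

/-- The function 1 - sinc is of order y² near 0 and bounded away from 0 elsewhere. It arises by
integrating characters over a symmetric interval, and the truncated square is the quantity to
recover from it. -/
lemma one_sub_sinc_lower_bound (y : ℝ) : 1 / 15 * (min |y| 1) ^ 2 ≤ 1 - Real.sinc y := by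
  wlog hy : 0 ≤ y generalizing y
  · have := this (-y) (by linarith)
    rwa [abs_neg, Real.sinc_neg] at this
  rw [abs_of_nonneg hy]
  rcases hy.eq_or_lt with rfl | hpos
  · simp
  rw [Real.sinc_of_ne_zero hpos.ne']
  have small : ∀ z : ℝ, 0 < z → z ≤ 1 → Real.sin z ≤ z - z ^ 3 / 7 :=
    fun z h0 h1 => by
      have := (abs_le.1 (Real.sin_bound (x := z) (by rwa [abs_of_pos h0]))).2
      rw [abs_of_pos h0] at this
      have : z ^ 5 ≤ z ^ 3 := pow_le_pow_of_le_one h0.le h1 (by norm_num)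
      have : 0 < z ^ 3 := by positivity
      linarith
  rcases le_total y 1 with h1 | h1
  · rw [min_eq_left h1, le_sub_comm, div_le_iff₀ hpos]
    refine (small y hpos h1).trans ?_
    have : 0 ≤ y ^ 3 := by positivity
    nlinarith
  · rw [min_eq_right h1, le_sub_comm, div_le_iff₀ hpos]
    -- Beyond 15/14 the bound sin y ≤ 1 ≤ 14y/15 suffices. Just after 1, the addition formula gives
    -- sin y ≤ sin 1 + (y - 1) ≤ y - 1/7.
    rcases le_total y (15 / 14) with h2 | h2
    · have hs1 := small 1 one_pos le_rfl
      have e : Real.sin y = Real.sin 1 * Real.cos (y - 1) + Real.cos 1 * Real.sin (y - 1) := by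
        rw [← Real.sin_add]; congr 1; ring
      have hs0 : 0 ≤ Real.sin 1 := Real.sin_nonneg_of_nonneg_of_le_pi zero_le_one
        (by linarith [Real.pi_gt_three])
      have hsy : 0 ≤ Real.sin (y - 1) := Real.sin_nonneg_of_nonneg_of_le_pi (by linarith)
        (by linarith [Real.pi_gt_three])
      have hsy' := Real.sin_le (x := y - 1) (by linarith)
      have h3 : Real.sin 1 * Real.cos (y - 1) ≤ Real.sin 1 :=
        mul_le_of_le_one_right hs0 (Real.cos_le_one _)
      have h4 : Real.cos 1 * Real.sin (y - 1) ≤ Real.sin (y - 1) :=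
        mul_le_of_le_one_left hsy (Real.cos_le_one _)
      linarith
    · linarith [Real.sin_le_one y]

/-- Each term of the geometric sum (1 - x^N)/(1 - x) is at least x^N ≥ 1/2, so 1 - x is at most
2z/N, and 1 - x² at most twice that. It is applied to x = |φ(u)|. -/
lemma mul_one_sub_sq_le_of_le_pow {x z : ℝ} {N : ℕ} (hx0 : 0 ≤ x) (hx1 : x ≤ 1)
    (hz : z ≤ 1 / 2) (h : 1 - z ≤ x ^ N) : N * (1 - x ^ 2) ≤ 4 * z := by
  have hgeom : (1 - x) * ∑ i ∈ Finset.range N, x ^ i = 1 - x ^ N := mul_neg_geom_sum x N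
  have hsum : (N : ℝ) * x ^ N ≤ ∑ i ∈ Finset.range N, x ^ i := by
    have := Finset.card_nsmul_le_sum (Finset.range N) (fun i => x ^ i) (x ^ N) fun i hi =>
      pow_le_pow_of_le_one hx0 hx1 (Finset.mem_range.1 hi).le
    simpa using this
  have h1 : 0 ≤ 1 - x := by linarith
  have h2 : (1 - x) * (N * x ^ N) ≤ 1 - x ^ N := by
    rw [← hgeom]; gcongr
  have hN : (0 : ℝ) ≤ N := Nat.cast_nonneg N
  have h3 : (1 - x) * (N * (1 / 2)) ≤ (1 - x) * (N * x ^ N) := by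
    gcongr
    linarith
  have h4 : (N : ℝ) * (1 - x ^ 2) ≤ N * (2 * (1 - x)) := by
    gcongr
    nlinarith
  linarith

/-! ### Symmetrization and its removal -/

section Symmetrization

variable (ν : Measure ℝ) [IsProbabilityMeasure ν]

/-- The law of the difference of two independent variables with law `ν`. -/
noncomputable def symmLaw (ν : Measure ℝ) : Measure ℝ := ν.conv (ν.map Neg.neg)

instance : IsProbabilityMeasure (ν.map Neg.neg) :=
  Measure.isProbabilityMeasure_map measurable_neg.aemeasurable

instance : IsProbabilityMeasure (symmLaw ν) := by
  unfold symmLaw; infer_instance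

lemma charFun_symmLaw (u : ℝ) : charFun (symmLaw ν) u = ((‖charFun ν u‖ ^ 2 : ℝ) : ℂ) := by
  have h : charFun (ν.map Neg.neg) u = (starRingEnd ℂ) (charFun ν u) := by
    have h1 := charFun_map_mul (μ := ν) (-1) u
    have h2 : (fun x : ℝ => -1 * x) = Neg.neg := by funext x; simp
    rw [h2] at h1
    rw [h1, neg_one_mul, charFun_neg]
  rw [symmLaw, charFun_conv, h, Complex.mul_conj, Complex.normSq_eq_norm_sq]

/-- The mean of 1 - |φ|² over |u| ≤ 1/N is the integral of 1 - sinc(x/N) against the symmetrized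
law. The constant 60 is 15 · 4, from the bounds on 1 - sinc and on 1 - |φ|². -/
lemma integral_min_sq_symmLaw_le {N : ℕ} (hN : 0 < N) {z : ℝ} (hz : z ≤ 1 / 2)
    (h : ∀ u : ℝ, |u| ≤ 1 / N → 1 - z ≤ ‖charFun ν u‖ ^ N) :
    ∫ x, (min |x| N) ^ 2 ∂(symmLaw ν) ≤ 60 * z * N := by
  have hN' : (0 : ℝ) < N := by exact_mod_cast hN
  set r : ℝ := 1 / N with hr
  have hr0 : 0 < r := by positivity
  have hsinc : Integrable (fun x => Real.sinc (r * x)) (symmLaw ν) :=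
    Integrable.of_bound (by fun_prop) 1
      (Eventually.of_forall fun x => Real.abs_sinc_le_one _)
  have hI : 2 * r * (1 - ∫ x, Real.sinc (r * x) ∂(symmLaw ν))
      = ∫ u in -r..r, (1 - ‖charFun ν u‖ ^ 2) := by
    have h1 := integral_charFun_Icc (μ := symmLaw ν) hr0
    simp only [charFun_symmLaw] at h1
    rw [intervalIntegral.integral_ofReal] at h1
    have h2 : ∫ u in -r..r, ‖charFun ν u‖ ^ 2 = 2 * r * ∫ x, Real.sinc (r * x) ∂(symmLaw ν) := by
      exact_mod_cast h1
    rw [intervalIntegral.integral_sub (by simp)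
      (Continuous.intervalIntegrable (by fun_prop) _ _), h2]
    simp
    ring
  have hII : ∫ u in -r..r, (1 - ‖charFun ν u‖ ^ 2) ≤ ∫ u in -r..r, 4 * z / N := by
    refine intervalIntegral.integral_mono_on (by linarith)
      (Continuous.intervalIntegrable (by fun_prop) _ _) (by simp) fun u hu => ?_
    rw [le_div_iff₀ hN', mul_comm]
    exact mul_one_sub_sq_le_of_le_pow (norm_nonneg _) (norm_charFun_le_one u) hz
      (h u (abs_le.2 hu))
  have hIII : 1 - ∫ x, Real.sinc (r * x) ∂(symmLaw ν) ≤ 4 * z / N := by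
    rw [← hI, intervalIntegral.integral_const, smul_eq_mul] at hII
    have : (r - -r) = 2 * r := by ring
    rw [this] at hII
    exact le_of_mul_le_mul_left hII (by positivity)
  have hIV : 1 / 15 * r ^ 2 * ∫ x, (min |x| N) ^ 2 ∂(symmLaw ν) ≤ 4 * z / N := by
    refine le_trans ?_ hIII
    have e : 1 - ∫ x, Real.sinc (r * x) ∂(symmLaw ν)
        = ∫ x, (1 - Real.sinc (r * x)) ∂(symmLaw ν) := by
      rw [integral_sub (integrable_const _) hsinc]
      simp
    rw [e, ← integral_const_mul]
    refine integral_mono ((integrable_min_sq _ hN'.le).const_mul _)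
      ((integrable_const _).sub hsinc) fun x => ?_
    refine le_trans (le_of_eq ?_) (one_sub_sinc_lower_bound (r * x))
    have : min |r * x| 1 = r * min |x| N := by
      rw [mul_min_of_nonneg _ _ hr0.le, abs_mul, abs_of_pos hr0, hr, one_div,
        inv_mul_cancel₀ hN'.ne']
    rw [this]
    ring
  rw [hr, le_div_iff₀ hN'] at hIV
  have e2 : 1 / 15 * (1 / (N : ℝ)) ^ 2 * (∫ x, (min |x| N) ^ 2 ∂(symmLaw ν)) * N
      = (∫ x, (min |x| N) ^ 2 ∂(symmLaw ν)) / (15 * N) := by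
    field_simp
  rw [e2, div_le_iff₀ (by positivity)] at hIV
  linarith

lemma min_abs_sq_le_sub {c : ℝ} (hc : 0 ≤ c) (x y : ℝ) :
    (min |x| c) ^ 2 ≤ 2 * (min |x - y| c) ^ 2 + 2 * y ^ 2 := by
  have h0 : 0 ≤ min |x| c := le_min (abs_nonneg _) hc
  have h1 : min |x| c ≤ min |x - y| c + |y| := by
    have : |x| ≤ |x - y| + |y| := by
      simpa using abs_add_le (x - y) y
    rcases le_total |x - y| c with h | h
    · rw [min_eq_left h]; exact (min_le_left _ _).trans this
    · rw [min_eq_right h]; exact (min_le_right _ _).trans (by linarith [abs_nonneg y])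
  calc (min |x| c) ^ 2 ≤ (min |x - y| c + |y|) ^ 2 := by gcongr
    _ ≤ 2 * (min |x - y| c) ^ 2 + 2 * |y| ^ 2 := by
      nlinarith [sq_nonneg (min |x - y| c - |y|)]
    _ = _ := by rw [sq_abs]

/-- Undoes the symmetrization: the independent copy y lies in [-K, K] with probability at least 3/4,
and there it perturbs the truncated square by at most 2K², up to a factor 2. -/
lemma integral_min_sq_le_symmLaw {c : ℝ} (hc : 0 ≤ c) {K : ℝ}
    (hν : ν.real {x | K < |x|} ≤ 1 / 4) :
    3 / 4 * ∫ x, (min |x| c) ^ 2 ∂ν ≤ 2 * ∫ x, (min |x| c) ^ 2 ∂(symmLaw ν) + 2 * K ^ 2 := by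
  have hbound : ∀ w : ℝ, ‖(min |w| c) ^ 2‖ ≤ c ^ 2 := fun w => by
    have : 0 ≤ min |w| c := le_min (abs_nonneg _) hc
    rw [Real.norm_eq_abs, abs_of_nonneg (by positivity)]
    gcongr
    exact min_le_right _ _
  have e : ∫ x, (min |x| c) ^ 2 ∂(symmLaw ν) = ∫ x, (∫ y, (min |x - y| c) ^ 2 ∂ν) ∂ν := by
    rw [symmLaw, integral_conv (integrable_min_sq _ hc)]
    congr 1
    funext x
    rw [integral_map measurable_neg.aemeasurable (by fun_prop)]
    simp only [sub_eq_add_neg]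
  have hprod : Integrable (fun p : ℝ × ℝ => (min |p.1 - p.2| c) ^ 2) (ν.prod ν) :=
    Integrable.of_bound (by fun_prop) (c ^ 2) (Eventually.of_forall fun p => hbound _)
  have hq : 3 / 4 ≤ ν.real {x : ℝ | |x| ≤ K} := by
    have h1 : {x : ℝ | |x| ≤ K} = {x : ℝ | K < |x|}ᶜ := by ext x; simp
    rw [h1, probReal_compl_eq_one_sub (measurableSet_lt_abs K)]
    linarith
  have hx : ∀ x : ℝ, 3 / 4 * (min |x| c) ^ 2
      ≤ 2 * ∫ y, (min |x - y| c) ^ 2 ∂ν + 2 * K ^ 2 := fun x => by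
    have hi : Integrable (fun y => (min |x - y| c) ^ 2) ν :=
      Integrable.of_bound (by fun_prop) (c ^ 2) (Eventually.of_forall fun y => hbound _)
    have hi2 : Integrable (fun y => 2 * (min |x - y| c) ^ 2 + 2 * K ^ 2) ν :=
      (hi.const_mul 2).add (integrable_const _)
    calc 3 / 4 * (min |x| c) ^ 2 ≤ ν.real {x : ℝ | |x| ≤ K} * (min |x| c) ^ 2 := by gcongr
      _ = ∫ y, {y : ℝ | |y| ≤ K}.indicator (fun _ => (min |x| c) ^ 2) y ∂ν := by
        rw [integral_indicator_const _ (measurableSet_abs_le K), smul_eq_mul]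
      _ ≤ ∫ y, (2 * (min |x - y| c) ^ 2 + 2 * K ^ 2) ∂ν := by
        refine integral_mono ((integrable_const _).indicator (measurableSet_abs_le K)) hi2
          fun y => ?_
        by_cases hy : |y| ≤ K
        · simp only [Set.indicator, Set.mem_ofPred_eq, hy, if_true]
          refine (min_abs_sq_le_sub hc x y).trans ?_
          have : y ^ 2 ≤ K ^ 2 := by rw [← sq_abs]; gcongr
          linarith
        · simp only [Set.indicator, Set.mem_ofPred_eq, hy, if_false]
          positivity
      _ = _ := by
        rw [integral_add (hi.const_mul 2) (integrable_const _), integral_const_mul]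
        simp
  rw [e, ← integral_const_mul]
  have hi3 : Integrable (fun x => 2 * ∫ y, (min |x - y| c) ^ 2 ∂ν) ν :=
    hprod.integral_prod_left.const_mul 2
  calc ∫ x, 3 / 4 * (min |x| c) ^ 2 ∂ν
      ≤ ∫ x, (2 * ∫ y, (min |x - y| c) ^ 2 ∂ν + 2 * K ^ 2) ∂ν :=
        integral_mono ((integrable_min_sq ν hc).const_mul _) (hi3.add (integrable_const _)) hx
    _ = _ := by
        rw [integral_add hi3 (integrable_const _), integral_const_mul]
        simp

/-- A quantitative converse of the weak law of large numbers: if the `N`-th power of the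
characteristic function is close to one in modulus near the origin, then the normalized truncated
second moment is small. -/
lemma truncSecond_le_of_charFun {N : ℕ} (hN : 0 < N) {z : ℝ} (hz : z ≤ 1 / 2)
    (h : ∀ u : ℝ, |u| ≤ 1 / N → 1 - z ≤ ‖charFun ν u‖ ^ N) {K : ℝ}
    (hν : ν.real {x | K < |x|} ≤ 1 / 4) :
    1 / N * ∫ x, (min |x| N) ^ 2 ∂ν ≤ 160 * z + 3 * K ^ 2 / N := by
  have hN' : (0 : ℝ) < N := by exact_mod_cast hN
  have h1 := integral_min_sq_symmLaw_le ν hN hz h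
  have h2 := integral_min_sq_le_symmLaw ν hN'.le hν
  rw [one_div, inv_mul_le_iff₀ hN']
  have e : (N : ℝ) * (160 * z + 3 * K ^ 2 / N) = 160 * z * N + 3 * K ^ 2 := by field_simp
  rw [e]
  -- Multiplying by 4/3 turns 2 · 60 into 160 and 2 into 8/3 ≤ 3.
  nlinarith [sq_nonneg K]

end Symmetrization

end ExchWLLN

namespace ExchWLLN

variable {Ω : Type*} [mΩ : MeasurableSpace Ω] {μ : Measure Ω} {g : ℕ → Ω → ℝ}

/-! ### Convergence to zero in probability -/

section InMeasure

variable {ι : Type*} {l : Filter ι} {F G : ι → Ω → ℝ}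

lemma tendstoInMeasure_zero_iff :
    TendstoInMeasure μ F l (fun _ => (0 : ℝ)) ↔
      ∀ δ : ℝ, 0 < δ → Tendsto (fun i => μ {ω | δ ≤ |F i ω|}) l (𝓝 0) := by
  rw [tendstoInMeasure_iff_norm]
  simp only [sub_zero, Real.norm_eq_abs]

/-- Made for bounds whose error depends on a quantile K: first K is fixed so that `E K` has almost
full measure, then i goes to its limit. Assuming |G| ≤ 1/2 costs nothing in the limit and is needed
for the characteristic function estimate. -/
lemma tendstoInMeasure_zero_of_le (hG : TendstoInMeasure μ G l (fun _ => (0 : ℝ)))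
    {E : ℕ → Set Ω} (hE : Tendsto (fun K => μ (E K)ᶜ) atTop (𝓝 0)) (C : ℝ) {c : ℕ → ι → ℝ}
    (hc : ∀ K, Tendsto (c K) l (𝓝 0))
    (h : ∀ K, ∀ᶠ i in l, ∀ᵐ ω ∂μ, ω ∈ E K → |G i ω| ≤ 1 / 2 → |F i ω| ≤ C * |G i ω| + c K i) :
    TendstoInMeasure μ F l (fun _ => (0 : ℝ)) := by
  rw [tendstoInMeasure_zero_iff] at hG ⊢
  intro δ hδ
  rw [ENNReal.tendsto_nhds_zero]
  intro η hη
  have hη2 : 0 < η / 2 := ENNReal.half_pos hη.ne'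
  obtain ⟨K, hK⟩ := ((ENNReal.tendsto_nhds_zero.1 hE) (η / 2) hη2).exists
  have hδ' : 0 < min (1 / 2) (δ / (2 * (|C| + 1))) := by positivity
  filter_upwards [h K, (hc K).eventually (gt_mem_nhds (half_pos hδ)),
    (ENNReal.tendsto_nhds_zero.1 (hG _ hδ')) (η / 2) hη2] with i h1 h2 h3
  calc μ {ω | δ ≤ |F i ω|}
      ≤ μ ((E K)ᶜ ∪ {ω | min (1 / 2) (δ / (2 * (|C| + 1))) ≤ |G i ω|}) := by
        refine measure_mono_ae ?_
        filter_upwards [h1] with ω hω hF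
        by_contra hcon
        replace hcon : ω ∉ (E K)ᶜ ∪ {ω | min (1 / 2) (δ / (2 * (|C| + 1))) ≤ |G i ω|} := hcon
        simp only [Set.mem_union, Set.mem_compl_iff, Set.mem_ofPred_eq, not_or, not_not,
          not_le, lt_min_iff] at hcon
        have hb := hω hcon.1 hcon.2.1.le
        have h4 : C * |G i ω| ≤ δ / 2 := by
          have h5 := hcon.2.2
          rw [lt_div_iff₀ (by positivity)] at h5
          have h6 : C * |G i ω| ≤ |C| * |G i ω| :=
            mul_le_mul_of_nonneg_right (le_abs_self C) (abs_nonneg _)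
          nlinarith [abs_nonneg (G i ω)]
        have hF' : δ ≤ |F i ω| := hF
        linarith
    _ ≤ η / 2 + η / 2 := (measure_union_le _ _).trans (add_le_add hK h3)
    _ = η := ENNReal.add_halves η

lemma tendstoInMeasure_zero_of_abs_le (hG : TendstoInMeasure μ G l (fun _ => (0 : ℝ))) (C : ℝ)
    (h : ∀ᶠ i in l, ∀ᵐ ω ∂μ, |F i ω| ≤ C * |G i ω|) :
    TendstoInMeasure μ F l (fun _ => (0 : ℝ)) := by
  refine tendstoInMeasure_zero_of_le hG (E := fun _ => Set.univ) (by simp) C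
    (c := fun _ _ => 0) (fun _ => tendsto_const_nhds) fun _ => ?_
  filter_upwards [h] with i hi
  filter_upwards [hi] with ω hω _ _
  simpa using hω

lemma tendstoInMeasure_zero_add (hF : TendstoInMeasure μ F l (fun _ => (0 : ℝ)))
    (hG : TendstoInMeasure μ G l (fun _ => (0 : ℝ))) :
    TendstoInMeasure μ (fun i ω => F i ω + G i ω) l (fun _ => (0 : ℝ)) := by
  rw [tendstoInMeasure_zero_iff] at hF hG ⊢
  intro δ hδ
  have h := (hF (δ / 2) (half_pos hδ)).add (hG (δ / 2) (half_pos hδ))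
  rw [add_zero] at h
  refine tendsto_of_tendsto_of_tendsto_of_le_of_le tendsto_const_nhds h (fun _ => zero_le)
    fun i => (measure_mono fun ω hω => ?_).trans (measure_union_le _ _)
  by_contra hcon
  simp only [Set.mem_union, Set.mem_ofPred_eq, not_or, not_le] at hcon hω
  have := abs_add_le (F i ω) (G i ω)
  linarith

lemma tendstoInMeasure_zero_iff_of_eq_mul {F G : ℝ → Ω → ℝ} {c : ℝ} (hc : 0 < c)
    (h : ∀ t, 0 < t → ∀ ω, F t ω = c * G t ω) :
    TendstoInMeasure μ F atTop (fun _ => (0 : ℝ)) ↔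
      TendstoInMeasure μ G atTop (fun _ => (0 : ℝ)) := by
  refine ⟨fun hF => tendstoInMeasure_zero_of_abs_le hF c⁻¹ ?_,
    fun hG => tendstoInMeasure_zero_of_abs_le hG c ?_⟩
  · filter_upwards [eventually_gt_atTop 0] with t ht
    refine Eventually.of_forall fun ω => ?_
    rw [h t ht, abs_mul, abs_of_pos hc, inv_mul_cancel_left₀ hc.ne']
  · filter_upwards [eventually_gt_atTop 0] with t ht
    refine Eventually.of_forall fun ω => ?_
    rw [h t ht, abs_mul, abs_of_pos hc]

end InMeasure

/-! ### The truncation conditions -/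

section Conditions

variable [IsProbabilityMeasure μ]

lemma measurable_tailLaw_real {S : Set ℝ} (hS : MeasurableSet S) :
    Measurable[tail g] fun ω => (tailLaw μ g ω).real S :=
  ((tailLaw μ g).measurable_coe hS).ennreal_toReal

/-- The set on which `K` is a quantile of order `3 / 4` of the tail-conditional law. -/
def quantileSet (μ : Measure Ω) [IsFiniteMeasure μ] (g : ℕ → Ω → ℝ) (K : ℕ) : Set Ω :=
  {ω | (tailLaw μ g ω).real {x | (K : ℝ) < |x|} ≤ 1 / 4}

/-- The quantile of the conditional law need not be bounded over ω, but it is finite for each ω, so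
these events exhaust the space up to small probability. -/
lemma tendsto_measure_compl_quantileSet (hg : ∀ n, Measurable (g n)) :
    Tendsto (fun K => μ (quantileSet μ g K)ᶜ) atTop (𝓝 0) := by
  have hpt : ∀ ω, Tendsto (fun K : ℕ => (tailLaw μ g ω).real {x | (K : ℝ) < |x|}) atTop (𝓝 0) := by
    intro ω
    have h := tendsto_measure_iInter_atTop (μ := tailLaw μ g ω)
      (s := fun K : ℕ => {x : ℝ | (K : ℝ) < |x|})
      (fun K => (measurableSet_lt_abs K).nullMeasurableSet)
      (fun K L hKL x hx => lt_of_le_of_lt (Nat.cast_le.2 hKL) (show (L : ℝ) < |x| from hx))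
      ⟨0, measure_ne_top _ _⟩
    have he : ⋂ K : ℕ, {x : ℝ | (K : ℝ) < |x|} = ∅ := by
      ext x
      simp only [Set.mem_iInter, Set.mem_ofPred_eq, Set.mem_empty_iff_false, iff_false, not_forall,
        not_lt]
      exact exists_nat_ge |x|
    rw [he, measure_empty] at h
    exact (ENNReal.tendsto_toReal ENNReal.zero_ne_top).comp h
  have h := tendstoInMeasure_of_tendsto_ae (μ := μ)
    (f := fun (K : ℕ) ω => (tailLaw μ g ω).real {x | (K : ℝ) < |x|}) (g := fun _ => (0 : ℝ))
    (fun K => ((measurable_tailLaw_real (measurableSet_lt_abs K)).mono (tail_le hg)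
      le_rfl).aestronglyMeasurable) (Eventually.of_forall hpt)
  rw [tendstoInMeasure_zero_iff] at h
  refine tendsto_of_tendsto_of_tendsto_of_le_of_le tendsto_const_nhds (h (1 / 4) (by norm_num))
    (fun _ => zero_le) fun K => measure_mono fun ω hω => ?_
  simp only [quantileSet, Set.mem_compl_iff, Set.mem_ofPred_eq, not_le] at hω ⊢
  exact hω.le.trans (le_abs_self _)

lemma condTail_nonneg (ε : ℝ) {t : ℝ} (ht : 0 < t) (ω : Ω) : 0 ≤ condTail μ g ε t ω := by
  unfold condTail; positivity

lemma condSecond_nonneg (ε : ℝ) {t : ℝ} (ht : 0 < t) (ω : Ω) : 0 ≤ condSecond μ g ε t ω :=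
  mul_nonneg (by positivity)
    (integral_nonneg fun x => Set.indicator_nonneg (fun y _ => sq_nonneg y) x)

lemma condVariance_nonneg (ε : ℝ) {t : ℝ} (ht : 0 < t) (ω : Ω) : 0 ≤ condVariance μ g ε t ω :=
  mul_nonneg (by positivity) (variance_nonneg _ _)

lemma condTruncSecond_nonneg (ε : ℝ) {t : ℝ} (ht : 0 < t) (ω : Ω) :
    0 ≤ condTruncSecond μ g ε t ω :=
  mul_nonneg (by positivity) (integral_nonneg fun x => sq_nonneg _)

lemma condTruncSecond_eq (ε : ℝ) {t : ℝ} (ht : 0 < t) (ω : Ω) :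
    condTruncSecond μ g ε t ω = condSecond μ g ε t ω + ε ^ 2 * condTail μ g ε t ω := by
  rw [condTruncSecond, condSecond, condTail, integral_min_sq]
  field_simp

lemma condVariance_le (ε : ℝ) {t : ℝ} (ht : 0 < t) (ω : Ω) :
    condVariance μ g ε t ω ≤ condSecond μ g ε t ω :=
  mul_le_mul_of_nonneg_left (variance_trunc_le _ _) (by positivity)

lemma condSecond_le (ε : ℝ) {t : ℝ} (ht : 0 < t) {K : ℕ} {ω : Ω} (hω : ω ∈ quantileSet μ g K) :
    condSecond μ g ε t ω ≤ 2 * condVariance μ g ε t ω + 4 * (K : ℝ) ^ 2 / t := by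
  have h := second_le_variance_trunc (tailLaw μ g ω) (ε * t) (Nat.cast_nonneg K) hω
  have h2 := mul_le_mul_of_nonneg_left h (show 0 ≤ 1 / t by positivity)
  rw [condSecond, condVariance]
  refine h2.trans (le_of_eq ?_)
  ring

lemma average_condTail_eq {ε M : ℝ} (hε : 0 < ε) (hM : 0 < M) (ω : Ω) :
    (1 / M) * ∫ t in Set.Ioc 0 M, condTail μ g ε t ω
      = 1 / (2 * ε ^ 2) * condTruncSecond μ g ε M ω := by
  unfold condTail condTruncSecond
  rw [integral_mul_measure_lt _ hε hM]
  ring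

lemma average_condSecond_eq {ε M : ℝ} (hε : 0 < ε) (hM : 0 < M) (ω : Ω) :
    M * ∫ t in Set.Ioi M, condSecond μ g ε t ω / t ^ 2
      = 1 / 2 * condTruncSecond μ g ε M ω := by
  unfold condSecond condTruncSecond
  rw [integral_second _ hε hM]
  field_simp

lemma average_condVariance_nonneg {ε M : ℝ} (hM : 0 < M) (ω : Ω) :
    0 ≤ M * ∫ t in Set.Ioi M, condVariance μ g ε t ω / t ^ 2 := by
  refine mul_nonneg hM.le (setIntegral_nonneg measurableSet_Ioi fun t ht => ?_)
  exact div_nonneg (condVariance_nonneg ε (hM.trans ht) ω) (sq_nonneg t)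

lemma average_condVariance_le {ε M : ℝ} (hε : 0 < ε) (hM : 0 < M) (ω : Ω) :
    M * ∫ t in Set.Ioi M, condVariance μ g ε t ω / t ^ 2
      ≤ M * ∫ t in Set.Ioi M, condSecond μ g ε t ω / t ^ 2 := by
  refine mul_le_mul_of_nonneg_left (setIntegral_mono_on (integrableOn_variance _ hε hM)
    (integrableOn_second _ hε hM) measurableSet_Ioi fun t ht => ?_) hM.le
  exact div_le_div_of_nonneg_right (condVariance_le ε (hM.trans ht) ω) (sq_nonneg t)

lemma average_condSecond_le {ε M : ℝ} (hε : 0 < ε) (hM : 0 < M) {K : ℕ} {ω : Ω}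
    (hω : ω ∈ quantileSet μ g K) :
    M * ∫ t in Set.Ioi M, condSecond μ g ε t ω / t ^ 2
      ≤ 2 * (M * ∫ t in Set.Ioi M, condVariance μ g ε t ω / t ^ 2) + 2 * (K : ℝ) ^ 2 / M := by
  have hV : IntegrableOn (fun t => condVariance μ g ε t ω / t ^ 2) (Set.Ioi M) :=
    integrableOn_variance _ hε hM
  -- The error 4K²/t, integrated against M dt/t² over t > M, becomes 2K²/M.
  have h3 := (integrableOn_Ioi_inv_cube hM).const_mul (4 * (K : ℝ) ^ 2)
  have h : ∫ t in Set.Ioi M, condSecond μ g ε t ω / t ^ 2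
      ≤ ∫ t in Set.Ioi M,
        (2 * (condVariance μ g ε t ω / t ^ 2) + 4 * (K : ℝ) ^ 2 * (1 / t ^ 3)) := by
    refine setIntegral_mono_on (integrableOn_second _ hε hM)
      ((hV.const_mul 2).add h3) measurableSet_Ioi fun t ht => ?_
    have ht : 0 < t := hM.trans ht
    have := div_le_div_of_nonneg_right (condSecond_le ε ht hω) (sq_nonneg t)
    refine this.trans (le_of_eq ?_)
    field_simp
  rw [integral_add (hV.const_mul 2) h3, integral_const_mul, integral_const_mul,
    integral_Ioi_inv_cube hM] at h
  refine (mul_le_mul_of_nonneg_left h hM.le).trans (le_of_eq ?_)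
  field_simp
  ring

lemma tendsto_const_div_atTop_real (c : ℝ) : Tendsto (fun t : ℝ => c / t) atTop (𝓝 0) :=
  tendsto_const_nhds.div_atTop tendsto_id

lemma tendsto_condTruncSecond_iff {ε : ℝ} (hε : 0 < ε) :
    TendstoInMeasure μ (fun t : ℝ => condTruncSecond μ g ε t) atTop (fun _ => (0 : ℝ)) ↔
      TendstoInMeasure μ (fun t : ℝ => condTail μ g ε t) atTop (fun _ => (0 : ℝ)) ∧
      TendstoInMeasure μ (fun t : ℝ => condSecond μ g ε t) atTop (fun _ => (0 : ℝ)) := by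
  refine ⟨fun h => ⟨?_, ?_⟩, fun h => ?_⟩
  · refine tendstoInMeasure_zero_of_abs_le h (1 / ε ^ 2) ?_
    filter_upwards [eventually_gt_atTop 0] with t ht
    refine Eventually.of_forall fun ω => ?_
    rw [abs_of_nonneg (condTail_nonneg ε ht ω), abs_of_nonneg (condTruncSecond_nonneg ε ht ω),
      condTruncSecond_eq ε ht, one_div, le_inv_mul_iff₀ (by positivity)]
    linarith [condSecond_nonneg (μ := μ) (g := g) ε ht ω]
  · refine tendstoInMeasure_zero_of_abs_le h 1 ?_
    filter_upwards [eventually_gt_atTop 0] with t ht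
    refine Eventually.of_forall fun ω => ?_
    rw [abs_of_nonneg (condSecond_nonneg ε ht ω), abs_of_nonneg (condTruncSecond_nonneg ε ht ω),
      condTruncSecond_eq ε ht, one_mul]
    have := condTail_nonneg (μ := μ) (g := g) ε ht ω
    have : 0 ≤ ε ^ 2 * condTail μ g ε t ω := by positivity
    linarith
  · have h1 : TendstoInMeasure μ (fun t ω => ε ^ 2 * condTail μ g ε t ω) atTop
        (fun _ => (0 : ℝ)) :=
      tendstoInMeasure_zero_of_abs_le h.1 (ε ^ 2)
        (Eventually.of_forall fun t => Eventually.of_forall fun ω => by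
          rw [abs_mul, abs_of_nonneg (sq_nonneg ε)])
    refine (tendstoInMeasure_zero_add h.2 h1).congr' ?_ (ae_eq_refl _)
    filter_upwards [eventually_gt_atTop 0] with t ht
    exact Eventually.of_forall fun ω => (condTruncSecond_eq ε ht ω).symm

lemma tendsto_condVariance_iff (hg : ∀ n, Measurable (g n)) (ε : ℝ) :
    TendstoInMeasure μ (fun t : ℝ => condVariance μ g ε t) atTop (fun _ => (0 : ℝ)) ↔
      TendstoInMeasure μ (fun t : ℝ => condSecond μ g ε t) atTop (fun _ => (0 : ℝ)) := by
  refine ⟨fun h => ?_, fun h => ?_⟩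
  · refine tendstoInMeasure_zero_of_le h (tendsto_measure_compl_quantileSet hg) 2
      (c := fun K t => 4 * (K : ℝ) ^ 2 / t) (fun K => tendsto_const_div_atTop_real _) fun K => ?_
    filter_upwards [eventually_gt_atTop 0] with t ht
    refine Eventually.of_forall fun ω hω _ => ?_
    rw [abs_of_nonneg (condSecond_nonneg ε ht ω), abs_of_nonneg (condVariance_nonneg ε ht ω)]
    exact condSecond_le ε ht hω
  · refine tendstoInMeasure_zero_of_abs_le h 1 ?_
    filter_upwards [eventually_gt_atTop 0] with t ht
    refine Eventually.of_forall fun ω => ?_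
    rw [abs_of_nonneg (condSecond_nonneg ε ht ω), abs_of_nonneg (condVariance_nonneg ε ht ω),
      one_mul]
    exact condVariance_le ε ht ω

lemma tendsto_average_condTail_iff {ε : ℝ} (hε : 0 < ε) :
    TendstoInMeasure μ
        (fun (M : ℝ) (ω : Ω) => (1 / M) * ∫ t in Set.Ioc 0 M, condTail μ g ε t ω)
        atTop (fun _ => (0 : ℝ)) ↔
      TendstoInMeasure μ (fun t : ℝ => condTruncSecond μ g ε t) atTop (fun _ => (0 : ℝ)) :=
  tendstoInMeasure_zero_iff_of_eq_mul (by positivity) fun _ hM ω => average_condTail_eq hε hM ω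

lemma tendsto_average_condSecond_iff {ε : ℝ} (hε : 0 < ε) :
    TendstoInMeasure μ
        (fun (M : ℝ) (ω : Ω) => M * ∫ t in Set.Ioi M, condSecond μ g ε t ω / t ^ 2)
        atTop (fun _ => (0 : ℝ)) ↔
      TendstoInMeasure μ (fun t : ℝ => condTruncSecond μ g ε t) atTop (fun _ => (0 : ℝ)) :=
  tendstoInMeasure_zero_iff_of_eq_mul (by norm_num) fun _ hM ω => average_condSecond_eq hε hM ω

lemma tendsto_average_condVariance_iff (hg : ∀ n, Measurable (g n)) {ε : ℝ} (hε : 0 < ε) :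
    TendstoInMeasure μ
        (fun (M : ℝ) (ω : Ω) => M * ∫ t in Set.Ioi M, condVariance μ g ε t ω / t ^ 2)
        atTop (fun _ => (0 : ℝ)) ↔
      TendstoInMeasure μ
        (fun (M : ℝ) (ω : Ω) => M * ∫ t in Set.Ioi M, condSecond μ g ε t ω / t ^ 2)
        atTop (fun _ => (0 : ℝ)) := by
  have hS : ∀ {M : ℝ} (_ : 0 < M) (ω : Ω),
      0 ≤ M * ∫ t in Set.Ioi M, condSecond μ g ε t ω / t ^ 2 := fun hM ω =>
    (average_condVariance_nonneg hM ω).trans (average_condVariance_le hε hM ω)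
  refine ⟨fun h => ?_, fun h => ?_⟩
  · refine tendstoInMeasure_zero_of_le h (tendsto_measure_compl_quantileSet hg) 2
      (c := fun K t => 2 * (K : ℝ) ^ 2 / t) (fun K => tendsto_const_div_atTop_real _) fun K => ?_
    filter_upwards [eventually_gt_atTop 0] with M hM
    refine Eventually.of_forall fun ω hω _ => ?_
    rw [abs_of_nonneg (hS hM ω), abs_of_nonneg (average_condVariance_nonneg hM ω)]
    exact average_condSecond_le hε hM hω
  · refine tendstoInMeasure_zero_of_abs_le h 1 ?_
    filter_upwards [eventually_gt_atTop 0] with M hM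
    refine Eventually.of_forall fun ω => ?_
    rw [abs_of_nonneg (hS hM ω), abs_of_nonneg (average_condVariance_nonneg hM ω), one_mul]
    exact average_condVariance_le hε hM ω

/-- It suffices to control the truncated second moments along the integers and for `ε = 1`. -/
lemma tendsto_condTruncSecond_of_nat
    (h : TendstoInMeasure μ (fun N : ℕ => condTruncSecond μ g 1 N) atTop (fun _ => (0 : ℝ)))
    {ε : ℝ} (hε : 0 < ε) :
    TendstoInMeasure μ (fun t : ℝ => condTruncSecond μ g ε t) atTop (fun _ => (0 : ℝ)) := by
  -- For N = ⌈at⌉, a ≥ ε makes the truncation level N at least εt, while a ≥ 1 and t ≥ 1 give N ≤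
  -- 2at, the comparison of 1/t with 1/N.
  set a : ℝ := max ε 1 with ha
  have ha1 : 1 ≤ a := le_max_right _ _
  have hlim : Tendsto (fun t : ℝ => ⌈a * t⌉₊) atTop atTop :=
    tendsto_nat_ceil_atTop.comp (tendsto_id.const_mul_atTop (by linarith))
  refine tendstoInMeasure_zero_of_abs_le (h.comp hlim) (2 * a) ?_
  filter_upwards [eventually_ge_atTop 1] with t ht
  have ht0 : 0 < t := by linarith
  have hat : 1 ≤ a * t := by nlinarith
  set N : ℕ := ⌈a * t⌉₊ with hN
  have hN1 : a * t ≤ N := Nat.le_ceil _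
  have hN2 : (N : ℝ) ≤ 2 * a * t := by
    have := Nat.ceil_lt_add_one (show 0 ≤ a * t by linarith)
    linarith
  have hN0 : (0 : ℝ) < N := by linarith
  refine Eventually.of_forall fun ω => ?_
  simp only [Function.comp]
  rw [abs_of_nonneg (condTruncSecond_nonneg ε ht0 ω),
    abs_of_nonneg (condTruncSecond_nonneg 1 hN0 ω), condTruncSecond, condTruncSecond, one_mul]
  have hmono : ∫ x, (min |x| (ε * t)) ^ 2 ∂(tailLaw μ g ω)
      ≤ ∫ x, (min |x| N) ^ 2 ∂(tailLaw μ g ω) := by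
    have hεt : 0 ≤ ε * t := by positivity
    refine integral_mono (integrable_min_sq _ hεt) (integrable_min_sq _ hN0.le) fun x => ?_
    have h0 : 0 ≤ min |x| (ε * t) := le_min (abs_nonneg _) hεt
    have h1 : ε * t ≤ N := le_trans (by gcongr; exact le_max_left _ _) hN1
    simp only
    gcongr
  have h1 : 1 / t ≤ 2 * a * (1 / N) := by
    rw [mul_one_div, div_le_div_iff₀ ht0 hN0]
    linarith
  rw [← mul_assoc]
  exact mul_le_mul h1 hmono (integral_nonneg fun x => sq_nonneg _) (by positivity)

end Conditions

end ExchWLLN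

namespace ExchWLLN

variable {Ω : Type*} [mΩ : MeasurableSpace Ω] {μ : Measure Ω} {g D : ℕ → Ω → ℝ}

/-! ### Convergence in probability and convergence of integrals -/

section L1

variable [IsProbabilityMeasure μ] {F : ℕ → Ω → ℝ}

lemma tendstoInMeasure_zero_of_integral (hF : ∀ n, 0 ≤ᵐ[μ] F n) (hi : ∀ n, Integrable (F n) μ)
    (h : Tendsto (fun n => ∫ ω, F n ω ∂μ) atTop (𝓝 0)) :
    TendstoInMeasure μ F atTop (fun _ => (0 : ℝ)) := by
  rw [tendstoInMeasure_iff_measureReal_norm]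
  intro δ hδ
  have h0 := h.div_const δ
  rw [zero_div] at h0
  refine squeeze_zero (fun n => measureReal_nonneg) (fun n => ?_) h0
  rw [le_div_iff₀ hδ, mul_comm]
  have h1 := mul_meas_ge_le_integral_of_nonneg (μ := μ) (f := fun ω => |F n ω|)
    (Eventually.of_forall fun ω => abs_nonneg _) (hi n).abs δ
  have h2 : ∫ ω, |F n ω| ∂μ = ∫ ω, F n ω ∂μ := by
    refine integral_congr_ae ?_
    filter_upwards [hF n] with ω hω using abs_of_nonneg hω
  rw [h2] at h1
  simpa only [sub_zero, Real.norm_eq_abs] using h1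

lemma tendsto_integral_zero_of_tendstoInMeasure (hF : ∀ n, 0 ≤ᵐ[μ] F n)
    (hF1 : ∀ n, ∀ᵐ ω ∂μ, F n ω ≤ 1) (hm : ∀ n, Measurable (F n))
    (h : TendstoInMeasure μ F atTop (fun _ => (0 : ℝ))) :
    Tendsto (fun n => ∫ ω, F n ω ∂μ) atTop (𝓝 0) := by
  rw [tendstoInMeasure_iff_measureReal_norm] at h
  refine Metric.tendsto_atTop'.2 fun η hη => ?_
  have hη2 : 0 < η / 2 := half_pos hη
  obtain ⟨n₀, hn₀⟩ := Metric.tendsto_atTop'.1 (h (η / 2) hη2) (η / 2) hη2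
  refine ⟨n₀, fun n hn => ?_⟩
  have hn := hn₀ n hn
  have hS : MeasurableSet {ω | η / 2 ≤ ‖F n ω - 0‖} :=
    measurableSet_le measurable_const ((hm n).sub_const 0).norm
  rw [Real.dist_eq, sub_zero] at hn ⊢
  rw [abs_of_nonneg measureReal_nonneg] at hn
  rw [abs_of_nonneg (integral_nonneg_of_ae (hF n))]
  calc ∫ ω, F n ω ∂μ
      ≤ ∫ ω, (η / 2 + {ω | η / 2 ≤ ‖F n ω - 0‖}.indicator (fun _ => (1 : ℝ)) ω) ∂μ := by
        refine integral_mono_of_nonneg (hF n)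
          ((integrable_const _).add ((integrable_const _).indicator hS)) ?_
        filter_upwards [hF1 n] with ω hω
        by_cases hmem : η / 2 ≤ ‖F n ω - 0‖
        · simp only [Set.indicator, Set.mem_ofPred_eq, hmem, if_true]
          linarith
        · simp only [Set.indicator, Set.mem_ofPred_eq, hmem, if_false]
          rw [sub_zero, Real.norm_eq_abs, not_le] at hmem
          linarith [le_abs_self (F n ω)]
    _ = η / 2 + μ.real {ω | η / 2 ≤ ‖F n ω - 0‖} := by
        rw [integral_add (integrable_const _) ((integrable_const _).indicator hS),
          integral_indicator_const _ hS]
        simp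
    _ < η := by linarith

end L1

lemma measurable_avg (hg : ∀ n, Measurable (g n)) (N : ℕ) : Measurable (avg g N) :=
  (Finset.measurable_sum _ fun n _ => hg n).const_mul _

/-- The conditional expectation, given the tail, of the truncated distance between the average
and the corrector. -/
noncomputable def condDist (μ : Measure Ω) (g D : ℕ → Ω → ℝ) (N : ℕ) : Ω → ℝ :=
  μ[fun ω => min 2 |avg g N ω - D N ω| | tail g]

lemma condDist_nonneg (N : ℕ) : 0 ≤ᵐ[μ] condDist μ g D N :=
  condExp_nonneg (Eventually.of_forall fun _ => le_min zero_le_two (abs_nonneg _))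

section WeakLaw

variable [IsProbabilityMeasure μ]

/-- The weak law and its conditional version are equivalent, with the same correctors. -/
theorem wlln_iff_condWLLN (hg : ∀ n, Measurable (g n)) : WLLN μ g D ↔ CondWLLN μ g D := by
  refine and_congr_right fun hD => forall₂_congr fun ε _ => ?_
  have hS : ∀ N, MeasurableSet {ω | ε < |avg g N ω - D N ω|} := fun N =>
    measurableSet_lt measurable_const
      ((measurable_avg hg N).sub ((hD N).mono (tail_le hg) le_rfl)).abs
  have hInt : ∀ N, Integrable ({ω | ε < |avg g N ω - D N ω|}.indicator fun _ => (1 : ℝ)) μ :=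
    fun N => (integrable_const _).indicator (hS N)
  have h0 : ∀ N, 0 ≤ᵐ[μ] μ⟦{ω | ε < |avg g N ω - D N ω|} | tail g⟧ := fun N =>
    condExp_nonneg (Eventually.of_forall fun ω => Set.indicator_nonneg (fun _ _ => zero_le_one) ω)
  have h1 : ∀ N, ∀ᵐ ω ∂μ, (μ⟦{ω | ε < |avg g N ω - D N ω|} | tail g⟧) ω ≤ 1 := fun N => by
    have h := condExp_mono (m := tail g) (hInt N) (integrable_const (1 : ℝ))
      (Eventually.of_forall fun ω => Set.indicator_le_self' (fun _ _ => zero_le_one) ω)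
    rw [condExp_const (tail_le hg)] at h
    exact h
  -- The conditional probabilities lie in [0, 1] and their means are the unconditional ones, so
  -- convergence to 0 in probability and in L¹ coincide.
  have hI : ∀ N, ∫ ω, (μ⟦{ω | ε < |avg g N ω - D N ω|} | tail g⟧) ω ∂μ
      = μ.real {ω | ε < |avg g N ω - D N ω|} := fun N => by
    rw [integral_condExp (tail_le hg), integral_indicator_const _ (hS N), smul_eq_mul, mul_one]
  refine ⟨fun h => ?_, fun h => ?_⟩
  · refine tendstoInMeasure_zero_of_integral h0 (fun N => integrable_condExp) ?_
    simpa only [hI] using h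
  · have := tendsto_integral_zero_of_tendstoInMeasure h0 h1
      (fun N => (stronglyMeasurable_condExp.mono (tail_le hg)).measurable) h
    simpa only [hI] using this

lemma WLLN.tendstoInMeasure (h : WLLN μ g D) :
    TendstoInMeasure μ (fun N ω => avg g N ω - D N ω) atTop (fun _ => (0 : ℝ)) := by
  rw [tendstoInMeasure_iff_measureReal_norm]
  intro δ hδ
  refine squeeze_zero (fun n => measureReal_nonneg) (fun n => measureReal_mono fun ω hω => ?_)
    (h.2 (δ / 2) (half_pos hδ))
  simp only [Set.mem_ofPred_eq, sub_zero, Real.norm_eq_abs] at hω ⊢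
  linarith

/-! ### From the weak law to the truncation conditions -/

lemma integrable_min_dist (hg : ∀ n, Measurable (g n)) (hD : ∀ N, Measurable[tail g] (D N))
    (N : ℕ) : Integrable (fun ω => min 2 |avg g N ω - D N ω|) μ := by
  have hm := measurable_avg hg N
  have hm' := (hD N).mono (tail_le hg) le_rfl
  refine Integrable.of_bound (by fun_prop) 2 (Eventually.of_forall fun ω => ?_)
  rw [Real.norm_eq_abs, abs_of_nonneg (le_min zero_le_two (abs_nonneg _))]
  exact min_le_left _ _

lemma WLLN.tendsto_condDist (hg : ∀ n, Measurable (g n)) (h : WLLN μ g D) :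
    TendstoInMeasure μ (condDist μ g D) atTop (fun _ => (0 : ℝ)) := by
  refine tendstoInMeasure_zero_of_integral condDist_nonneg (fun N => integrable_condExp) ?_
  have e : ∀ N, ∫ ω, condDist μ g D N ω ∂μ = 2 * ∫ ω, min 1 (|avg g N ω - D N ω| / 2) ∂μ :=
    fun N => by
      rw [condDist, integral_condExp (tail_le hg), ← integral_const_mul]
      congr 1
      funext ω
      rw [mul_min_of_nonneg _ _ zero_le_two, mul_one, mul_div_cancel₀ _ two_ne_zero]
  simp only [e]
  have hlim := tendsto_integral_zero_of_tendstoInMeasure (μ := μ)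
    (F := fun N ω => min 1 (|avg g N ω - D N ω| / 2))
    (fun N => Eventually.of_forall fun ω => le_min zero_le_one (by positivity))
    (fun N => Eventually.of_forall fun ω => min_le_left _ _)
    (fun N => by
      have hm := measurable_avg hg N
      have hm' := (h.1 N).mono (tail_le hg) le_rfl
      fun_prop)
    (tendstoInMeasure_zero_of_abs_le h.tendstoInMeasure 1
      (Eventually.of_forall fun N => Eventually.of_forall fun ω => by
        rw [abs_of_nonneg (le_min zero_le_one (by positivity)), one_mul]
        exact (min_le_right _ _).trans (half_le_self (abs_nonneg _))))
  simpa using hlim.const_mul 2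

/-- For |y| ≥ 2 this is cos ≥ -1; for |y| ≤ 2 it follows from cos x ≥ 1 - x²/2 and y² ≤ 2|y|. Hence
the truncation at 2 in `condDist`. -/
lemma one_sub_min_le_cos {v : ℝ} (hv : |v| ≤ 1) (y : ℝ) : 1 - min 2 |y| ≤ Real.cos (v * y) := by
  have h1 := Real.neg_one_le_cos (v * y)
  have h2 := Real.one_sub_sq_div_two_le_cos (x := v * y)
  have h3 : (v * y) ^ 2 ≤ y ^ 2 := by
    rw [mul_pow]
    have : v ^ 2 ≤ 1 := by rw [← sq_abs]; nlinarith [abs_nonneg v]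
    nlinarith [sq_nonneg y]
  rcases le_total 2 |y| with h | h
  · rw [min_eq_left h]; linarith
  · rw [min_eq_right h]
    have : y ^ 2 ≤ 2 * |y| := by rw [← sq_abs]; nlinarith [abs_nonneg y]
    linarith

/-- The conditional characteristic function of the centred average. -/
lemma Exchangeable.condExp_cos (hex : Exchangeable μ g) (hg : ∀ n, Measurable (g n))
    (hD : ∀ N, Measurable[tail g] (D N)) {N : ℕ} (hN : 0 < N) (u : ℝ) :
    (fun ω => (Complex.exp (-(N * u * D N ω : ℝ) * Complex.I) *
        charFun (tailLaw μ g ω) u ^ N).re) =ᵐ[μ]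
      μ[fun ω => Real.cos (N * u * (avg g N ω - D N ω)) | tail g] := by
  have hN' : (N : ℝ) ≠ 0 := by positivity
  have hf : Measurable fun x : ℝ => Complex.exp (u * x * Complex.I) := by fun_prop
  have hf1 : ∀ x : ℝ, ‖Complex.exp (u * x * Complex.I)‖ ≤ 1 := fun x => by
    rw [← Complex.ofReal_mul, Complex.norm_exp_ofReal_mul_I]
  have hφ : Measurable[tail g] fun ω => charFun (tailLaw μ g ω) u := by
    simp only [charFun_apply_real]
    exact measurable_integral_tailLaw hf.stronglyMeasurable
  have hE : Measurable[tail g] fun ω => Complex.exp (-(N * u * D N ω : ℝ) * Complex.I) := by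
    have := hD N
    exact (Complex.measurable_exp.comp ((Complex.measurable_ofReal.comp
      (this.const_mul (N * u))).neg.mul_const _))
  have hE1 : ∀ ω, ‖Complex.exp (-(N * u * D N ω : ℝ) * Complex.I)‖ ≤ 1 := fun ω => by
    rw [← Complex.ofReal_neg, Complex.norm_exp_ofReal_mul_I]
  have hprod : Measurable[tail g] fun ω => Complex.exp (-(N * u * D N ω : ℝ) * Complex.I) *
        charFun (tailLaw μ g ω) u ^ N := hE.mul (hφ.pow_const N)
  have hprod1 : ∀ ω, ‖Complex.exp (-(N * u * D N ω : ℝ) * Complex.I) *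
        charFun (tailLaw μ g ω) u ^ N‖ ≤ 1 := fun ω => by
    rw [norm_mul, norm_pow]
    exact mul_le_one₀ (hE1 ω) (by positivity)
      (pow_le_one₀ (norm_nonneg _) (norm_charFun_le_one u))
  have hprodi : Integrable (fun ω => Complex.exp (-(N * u * D N ω : ℝ) * Complex.I) *
        charFun (tailLaw μ g ω) u ^ N) μ :=
    Integrable.of_bound (hprod.mono (tail_le hg) le_rfl).aestronglyMeasurable 1
      (Eventually.of_forall hprod1)
  have hsum : ∀ ω, Complex.exp (-(N * u * D N ω : ℝ) * Complex.I) *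
      ∏ k ∈ Finset.range N, Complex.exp (u * g k ω * Complex.I) =
      Complex.exp ((N * u * (avg g N ω - D N ω) : ℝ) * Complex.I) := fun ω => by
    rw [← Complex.exp_sum, ← Complex.exp_add, ← Finset.sum_mul, ← Finset.mul_sum]
    congr 1
    simp only [avg]
    push_cast
    have : (N : ℂ) ≠ 0 := by exact_mod_cast hN'
    field_simp
    ring
  have hm := measurable_avg hg N
  have hm' := (hD N).mono (tail_le hg) le_rfl
  have hexpi : Integrable
      (fun ω => Complex.exp ((N * u * (avg g N ω - D N ω) : ℝ) * Complex.I)) μ :=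
    Integrable.of_bound (by fun_prop) 1 (Eventually.of_forall fun ω => by
      rw [Complex.norm_exp_ofReal_mul_I])
  have hre : (fun ω => Real.cos (N * u * (avg g N ω - D N ω))) =
      fun ω => (Complex.exp ((N * u * (avg g N ω - D N ω) : ℝ) * Complex.I)).re := by
    funext ω
    rw [Complex.exp_ofReal_mul_I_re]
  rw [hre]
  refine ae_eq_condExp_of_forall_setIntegral_eq (tail_le hg) hexpi.re
    (fun s _ _ => hprodi.re.integrableOn) (fun B hB _ => ?_)
    (Complex.measurable_re.comp hprod).stronglyMeasurable.aestronglyMeasurable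
  have hBm := tail_le hg B hB
  -- The corrector is tail-measurable, so its character, restricted to B, is an admissible weight.
  have key := hex.integral_tail_mul_prod hg (f := fun _ x => Complex.exp (u * x * Complex.I))
    (fun _ => hf) (fun _ => hf1) (Finset.range N)
    (W := B.indicator fun ω => Complex.exp (-(N * u * D N ω : ℝ) * Complex.I))
    (hE.indicator hB) (K := 1) (fun ω => (norm_indicator_le_norm_self _ _).trans (hE1 ω))
  have hind : ∀ a b : Ω → ℂ, ∫ ω, B.indicator a ω * b ω ∂μ = ∫ ω in B, a ω * b ω ∂μ :=
    fun a b => by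
      rw [← integral_indicator hBm]
      congr 1
      funext ω
      by_cases hω : ω ∈ B <;> simp [hω]
  simp only [← charFun_apply_real, Finset.prod_const, Finset.card_range] at key
  rw [hind, hind] at key
  simp only [hsum] at key
  have h1 : ∫ ω in B, (Complex.exp ((N * u * (avg g N ω - D N ω) : ℝ) * Complex.I)).re ∂μ
      = (∫ ω in B, Complex.exp ((N * u * (avg g N ω - D N ω) : ℝ) * Complex.I) ∂μ).re :=
    integral_re hexpi.integrableOn
  have h2 : ∫ ω in B, (Complex.exp (-(N * u * D N ω : ℝ) * Complex.I) *
        charFun (tailLaw μ g ω) u ^ N).re ∂μ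
      = (∫ ω in B, Complex.exp (-(N * u * D N ω : ℝ) * Complex.I) *
        charFun (tailLaw μ g ω) u ^ N ∂μ).re :=
    integral_re hprodi.integrableOn
  rw [h1, h2, key]

/-- Bounding the real part by the modulus discards the phase coming from the corrector, about which
nothing is known. -/
lemma Exchangeable.one_sub_condDist_le (hex : Exchangeable μ g) (hg : ∀ n, Measurable (g n))
    (hD : ∀ N, Measurable[tail g] (D N)) {N : ℕ} (hN : 0 < N) {u : ℝ} (hu : |u| ≤ 1 / N) :
    ∀ᵐ ω ∂μ, 1 - condDist μ g D N ω ≤ ‖charFun (tailLaw μ g ω) u‖ ^ N := by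
  have hN' : (0 : ℝ) < N := by positivity
  have hv : |(N : ℝ) * u| ≤ 1 := by
    rw [abs_mul, abs_of_pos hN', mul_comm]
    exact (le_div_iff₀ hN').1 hu
  have hm := measurable_avg hg N
  have hm' := (hD N).mono (tail_le hg) le_rfl
  have hmin := integrable_min_dist (μ := μ) hg hD N
  have hcos : Integrable (fun ω => Real.cos (N * u * (avg g N ω - D N ω))) μ :=
    Integrable.of_bound (by fun_prop) 1 (Eventually.of_forall fun ω => Real.abs_cos_le_one _)
  have hmono := condExp_mono (m := tail g) ((integrable_const (1 : ℝ)).sub hmin) hcos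
    (Eventually.of_forall fun ω => one_sub_min_le_cos hv (avg g N ω - D N ω))
  have hsub := condExp_sub (m := tail g) (integrable_const (1 : ℝ)) hmin
  rw [condExp_const (tail_le hg)] at hsub
  filter_upwards [hmono, hsub, hex.condExp_cos hg hD hN u] with ω h1 h2 h3
  rw [h2, ← h3] at h1
  refine h1.trans ((Complex.re_le_norm _).trans (le_of_eq ?_))
  rw [norm_mul, norm_pow, ← Complex.ofReal_neg, Complex.norm_exp_ofReal_mul_I, one_mul]

/-- The exceptional null set depends on u, while the bound will be integrated in u for fixed ω.
Rational u and continuity of the characteristic function give one null set for all u. -/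
lemma Exchangeable.ae_forall_one_sub_condDist_le (hex : Exchangeable μ g)
    (hg : ∀ n, Measurable (g n)) (hD : ∀ N, Measurable[tail g] (D N)) {N : ℕ} (hN : 0 < N) :
    ∀ᵐ ω ∂μ, ∀ u : ℝ, |u| ≤ 1 / N →
      1 - condDist μ g D N ω ≤ ‖charFun (tailLaw μ g ω) u‖ ^ N := by
  have hr : (0 : ℝ) ≤ 1 / N := by positivity
  -- Clamping to [-1/N, 1/N] turns the inequality into a closed condition on all of ℝ, where the
  -- rationals are dense.
  have hclamp : ∀ q : ℝ, |max (-(1 / N : ℝ)) (min (1 / N) q)| ≤ 1 / N := fun q =>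
    abs_le.2 ⟨le_max_left _ _, max_le (by linarith) (min_le_left _ _)⟩
  have h := ae_all_iff.2 fun q : ℚ => hex.one_sub_condDist_le hg hD hN (hclamp q)
  filter_upwards [h] with ω hω u hu
  have hcl : IsClosed {q : ℝ | 1 - condDist μ g D N ω ≤
      ‖charFun (tailLaw μ g ω) (max (-(1 / N : ℝ)) (min (1 / N) q))‖ ^ N} :=
    isClosed_le continuous_const (by fun_prop)
  have hall := Rat.denseRange_cast.induction_on (p := fun q : ℝ => 1 - condDist μ g D N ω ≤
      ‖charFun (tailLaw μ g ω) (max (-(1 / N : ℝ)) (min (1 / N) q))‖ ^ N) u hcl hω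
  rwa [min_eq_right (abs_le.1 hu).2, max_eq_right (abs_le.1 hu).1] at hall

theorem Exchangeable.tendsto_condTruncSecond_of_wlln (hex : Exchangeable μ g)
    (hg : ∀ n, Measurable (g n)) (h : WLLN μ g D) :
    TendstoInMeasure μ (fun N : ℕ => condTruncSecond μ g 1 N) atTop (fun _ => (0 : ℝ)) := by
  refine tendstoInMeasure_zero_of_le (h.tendsto_condDist hg)
    (tendsto_measure_compl_quantileSet hg) 160 (c := fun K N => 3 * (K : ℝ) ^ 2 / N)
    (fun K => (tendsto_const_div_atTop_real _).comp tendsto_natCast_atTop_atTop) fun K => ?_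
  filter_upwards [eventually_gt_atTop 0] with N hN
  filter_upwards [hex.ae_forall_one_sub_condDist_le hg h.1 hN, condDist_nonneg N]
    with ω h1 h0 hω hz
  have h0 : 0 ≤ condDist μ g D N ω := h0
  rw [abs_of_nonneg h0] at hz ⊢
  rw [abs_of_nonneg (condTruncSecond_nonneg 1 (by positivity) ω), condTruncSecond, one_mul]
  exact truncSecond_le_of_charFun (tailLaw μ g ω) hN hz h1 hω

end WeakLaw

end ExchWLLN

namespace ExchWLLN

variable {Ω : Type*} [mΩ : MeasurableSpace Ω] {μ : Measure Ω} {g D : ℕ → Ω → ℝ}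

section Sufficiency

variable [IsProbabilityMeasure μ]

/-! ### From the truncation conditions to the weak law -/

lemma Exchangeable.integral_tail_mul_comp (hex : Exchangeable μ g) (hg : ∀ n, Measurable (g n))
    {f : ℝ → ℝ} (hf : Measurable f) {C : ℝ} (hC : ∀ x, |f x| ≤ C) {w : Ω → ℝ}
    (hw : Measurable[tail g] w) {K : ℝ} (hK : ∀ ω, |w ω| ≤ K) (k : ℕ) :
    ∫ ω, w ω * f (g k ω) ∂μ = ∫ ω, w ω * ∫ x, f x ∂(tailLaw μ g ω) ∂μ := by
  have h := hex.integral_tail_mul_prod hg (f := fun _ x => (f x : ℂ)) (fun _ => by fun_prop)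
    (C := C) (fun _ x => by simpa using hC x) {k} (W := fun ω => (w ω : ℂ))
    (Complex.measurable_ofReal.comp hw) (K := K) (fun ω => by simpa using hK ω)
  simp only [Finset.prod_singleton, integral_complex_ofReal, ← Complex.ofReal_mul] at h
  exact_mod_cast h

lemma Exchangeable.integral_tail_mul_comp_mul_comp (hex : Exchangeable μ g)
    (hg : ∀ n, Measurable (g n)) {f : ℝ → ℝ} (hf : Measurable f) {C : ℝ} (hC : ∀ x, |f x| ≤ C)
    {w : Ω → ℝ} (hw : Measurable[tail g] w) {K : ℝ} (hK : ∀ ω, |w ω| ≤ K) {i j : ℕ}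
    (hij : i ≠ j) :
    ∫ ω, w ω * (f (g i ω) * f (g j ω)) ∂μ
      = ∫ ω, w ω * (∫ x, f x ∂(tailLaw μ g ω)) ^ 2 ∂μ := by
  have h := hex.integral_tail_mul_prod hg (f := fun _ x => (f x : ℂ)) (fun _ => by fun_prop)
    (C := C) (fun _ x => by simpa using hC x) {i, j} (W := fun ω => (w ω : ℂ))
    (Complex.measurable_ofReal.comp hw) (K := K) (fun ω => by simpa using hK ω)
  simp only [Finset.prod_pair hij, integral_complex_ofReal, ← Complex.ofReal_mul, ← sq] at h
  exact_mod_cast h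

/-- The conditional mean square deviation of an average from the conditional mean. -/
lemma Exchangeable.integral_tail_mul_sq_sum (hex : Exchangeable μ g)
    (hg : ∀ n, Measurable (g n)) {f : ℝ → ℝ} (hf : Measurable f) {C : ℝ} (hC : ∀ x, |f x| ≤ C)
    {w : Ω → ℝ} (hw : Measurable[tail g] w) {K : ℝ} (hK : ∀ ω, |w ω| ≤ K) (N : ℕ) :
    ∫ ω, w ω * (∑ k ∈ Finset.range N, (f (g k ω) - ∫ x, f x ∂(tailLaw μ g ω))) ^ 2 ∂μ
      = N * ∫ ω, w ω * (∫ x, f x ^ 2 ∂(tailLaw μ g ω) - (∫ x, f x ∂(tailLaw μ g ω)) ^ 2) ∂μ := by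
  set m : Ω → ℝ := fun ω => ∫ x, f x ∂(tailLaw μ g ω) with hm
  have hmm : Measurable[tail g] m := measurable_integral_tailLaw hf.stronglyMeasurable
  have hmC : ∀ ω, |m ω| ≤ C := fun ω =>
    norm_integral_tailLaw_le (f := f) (fun x => hC x) ω
  have hm' := hmm.mono (tail_le hg) le_rfl
  have hw' := hw.mono (tail_le hg) le_rfl
  have hC0 : 0 ≤ C := (abs_nonneg _).trans (hC 0)
  have hwm : Measurable[tail g] fun ω => w ω * m ω := hw.mul hmm
  have hK0 : ∀ ω : Ω, 0 ≤ K := fun ω => (abs_nonneg _).trans (hK ω)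
  have hwmK : ∀ ω, |w ω * m ω| ≤ K * C := fun ω => by
    rw [abs_mul]
    exact mul_le_mul (hK ω) (hmC ω) (abs_nonneg _) (hK0 ω)
  have hwi : Integrable w μ :=
    Integrable.of_bound hw'.aestronglyMeasurable K (Eventually.of_forall hK)
  have hwmi : Integrable (fun ω => w ω * m ω) μ :=
    Integrable.of_bound (hw'.mul hm').aestronglyMeasurable (K * C) (Eventually.of_forall hwmK)
  have hi1 : ∀ i, Integrable (fun ω => w ω * m ω * f (g i ω)) μ := fun i =>
    hwmi.mul_bdd (hf.comp (hg i)).aestronglyMeasurable (Eventually.of_forall fun ω => hC _)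
  have hi2 : ∀ i j, Integrable (fun ω => w ω * (f (g i ω) * f (g j ω))) μ := fun i j => by
    have := (hwi.mul_bdd (hf.comp (hg i)).aestronglyMeasurable
      (Eventually.of_forall fun ω => hC (g i ω))).mul_bdd
      (hf.comp (hg j)).aestronglyMeasurable (Eventually.of_forall fun ω => hC (g j ω))
    simpa only [mul_assoc, Function.comp] using this
  have hi3 : Integrable (fun ω => w ω * m ω ^ 2) μ := by
    have := hwmi.mul_bdd hm'.aestronglyMeasurable (Eventually.of_forall hmC)
    simpa only [mul_assoc, sq] using this
  have hi4 : Integrable (fun ω => w ω * ∫ x, f x ^ 2 ∂(tailLaw μ g ω)) μ := by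
    refine hwi.mul_bdd (c := C ^ 2) ((measurable_integral_tailLaw
      (hf.pow_const 2).stronglyMeasurable).mono (tail_le hg) le_rfl).aestronglyMeasurable
      (Eventually.of_forall fun ω => norm_integral_tailLaw_le (fun x => ?_) ω)
    rw [norm_pow]
    exact pow_le_pow_left₀ (norm_nonneg _) (hC x) 2
  have hexp : ∀ i j, ∫ ω, w ω * ((f (g i ω) - m ω) * (f (g j ω) - m ω)) ∂μ
      = ∫ ω, w ω * (f (g i ω) * f (g j ω)) ∂μ - ∫ ω, w ω * m ω * f (g i ω) ∂μ
        - ∫ ω, w ω * m ω * f (g j ω) ∂μ + ∫ ω, w ω * m ω ^ 2 ∂μ := fun i j => by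
    have hs1 : Integrable
        (fun ω => w ω * (f (g i ω) * f (g j ω)) - w ω * m ω * f (g i ω)) μ :=
      (hi2 i j).sub (hi1 i)
    have hs2 : Integrable (fun ω => w ω * (f (g i ω) * f (g j ω)) - w ω * m ω * f (g i ω)
        - w ω * m ω * f (g j ω)) μ := hs1.sub (hi1 j)
    rw [← integral_sub (hi2 i j) (hi1 i), ← integral_sub hs1 (hi1 j), ← integral_add hs2 hi3]
    congr 1
    funext ω
    ring
  have hlin : ∀ i, ∫ ω, w ω * m ω * f (g i ω) ∂μ = ∫ ω, w ω * m ω ^ 2 ∂μ := fun i => by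
    rw [hex.integral_tail_mul_comp hg hf hC hwm hwmK i]
    simp only [mul_assoc, sq, hm]
  -- Off the diagonal, conditional independence annihilates the covariance; each diagonal term gives
  -- the conditional variance.
  have hpair : ∀ i j, ∫ ω, w ω * ((f (g i ω) - m ω) * (f (g j ω) - m ω)) ∂μ
      = if i = j then ∫ ω, w ω * (∫ x, f x ^ 2 ∂(tailLaw μ g ω) - m ω ^ 2) ∂μ else 0 :=
    fun i j => by
      rw [hexp, hlin, hlin]
      split_ifs with hij
      · subst hij
        have h := hex.integral_tail_mul_comp hg (f := fun x => f x ^ 2) (hf.pow_const 2)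
          (C := C ^ 2) (fun x => by rw [abs_pow]; exact pow_le_pow_left₀ (abs_nonneg _) (hC x) 2)
          hw hK i
        simp only [← sq] at h ⊢
        rw [h]
        simp only [mul_sub]
        rw [integral_sub hi4 hi3]
        ring
      · rw [hex.integral_tail_mul_comp_mul_comp hg hf hC hw hK hij]
        simp only [hm]
        ring
  have hi5 : ∀ i j, Integrable (fun ω => w ω * ((f (g i ω) - m ω) * (f (g j ω) - m ω))) μ :=
    fun i j => by
      have := (((hi2 i j).sub (hi1 i)).sub (hi1 j)).add hi3
      refine this.congr (Eventually.of_forall fun ω => ?_)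
      simp only [Pi.sub_apply, Pi.add_apply]
      ring
  calc ∫ ω, w ω * (∑ k ∈ Finset.range N, (f (g k ω) - m ω)) ^ 2 ∂μ
      = ∫ ω, ∑ i ∈ Finset.range N, ∑ j ∈ Finset.range N,
          w ω * ((f (g i ω) - m ω) * (f (g j ω) - m ω)) ∂μ := by
        congr 1
        funext ω
        rw [sq, Finset.sum_mul_sum, Finset.mul_sum]
        simp only [Finset.mul_sum]
    _ = ∑ i ∈ Finset.range N, ∑ j ∈ Finset.range N,
          ∫ ω, w ω * ((f (g i ω) - m ω) * (f (g j ω) - m ω)) ∂μ := by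
        rw [integral_finsetSum _ fun i _ => integrable_finsetSum _ fun j _ => hi5 i j]
        exact Finset.sum_congr rfl fun i _ => integral_finsetSum _ fun j _ => hi5 i j
    _ = N * ∫ ω, w ω * (∫ x, f x ^ 2 ∂(tailLaw μ g ω) - m ω ^ 2) ∂μ := by
        simp only [hpair, Finset.sum_ite_eq]
        rw [Finset.sum_congr rfl fun i hi => if_pos hi]
        simp

lemma measurable_condTruncSecond (ε t : ℝ) : Measurable[tail g] (condTruncSecond μ g ε t) :=
  (measurable_integral_tailLaw (f := fun x : ℝ => (min |x| (ε * t)) ^ 2)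
    (Measurable.stronglyMeasurable (by fun_prop))).const_mul _

lemma measurable_condMean (ε t : ℝ) : Measurable[tail g] (condMean μ g ε t) :=
  measurable_integral_tailLaw (measurable_trunc _).stronglyMeasurable

lemma condTail_le_condTruncSecond {t : ℝ} (ht : 0 < t) (ω : Ω) :
    condTail μ g 1 t ω ≤ condTruncSecond μ g 1 t ω := by
  rw [condTruncSecond_eq 1 ht]
  linarith [condSecond_nonneg (μ := μ) (g := g) 1 ht ω]

lemma condSecond_le_condTruncSecond {t : ℝ} (ht : 0 < t) (ω : Ω) :
    condSecond μ g 1 t ω ≤ condTruncSecond μ g 1 t ω := by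
  rw [condTruncSecond_eq 1 ht]
  linarith [condTail_nonneg (μ := μ) (g := g) 1 ht ω]

/-- On a tail event where the truncated second moment is small, it is unlikely that one of the
first `N` terms exceeds `N`. -/
lemma Exchangeable.measure_exists_lt_abs_le (hex : Exchangeable μ g) (hg : ∀ n, Measurable (g n))
    {N : ℕ} (hN : 0 < N) {δ : ℝ} (hδ : 0 < δ) :
    μ.real ({ω | condTruncSecond μ g 1 N ω < δ} ∩
      {ω | ∃ k ∈ Finset.range N, (N : ℝ) < |g k ω|}) ≤ δ := by
  have hN' : (0 : ℝ) < N := by positivity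
  set B := {ω | condTruncSecond μ g 1 N ω < δ} with hBdef
  have hB : MeasurableSet[tail g] B := measurable_condTruncSecond 1 N measurableSet_Iio
  have hBm := tail_le hg B hB
  have hw : Measurable[tail g] (B.indicator fun _ => (1 : ℝ)) :=
    (@measurable_const _ _ _ (tail g) (1 : ℝ)).indicator hB
  have hw1 : ∀ ω, |B.indicator (fun _ => (1 : ℝ)) ω| ≤ 1 := fun ω => by
    by_cases h : ω ∈ B <;> simp [h]
  have hS := measurableSet_lt_abs (N : ℝ)
  have hterm : ∀ k, μ.real (B ∩ {ω | (N : ℝ) < |g k ω|})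
      = ∫ ω, B.indicator (fun _ => (1 : ℝ)) ω * (tailLaw μ g ω).real {x | (N : ℝ) < |x|} ∂μ :=
    fun k => by
      have h := hex.integral_tail_mul_comp hg
        (f := {x : ℝ | (N : ℝ) < |x|}.indicator fun _ => (1 : ℝ))
        (measurable_const.indicator hS) (C := 1)
        (fun x => by by_cases hx : (N : ℝ) < |x| <;> simp [Set.indicator, hx]) hw hw1 k
      simp only [integral_indicator_const _ hS, smul_eq_mul, mul_one] at h
      rw [← h]
      have e : (fun ω => B.indicator (fun _ => (1 : ℝ)) ω *
          {x : ℝ | (N : ℝ) < |x|}.indicator (fun _ => (1 : ℝ)) (g k ω)) =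
          (B ∩ {ω | (N : ℝ) < |g k ω|}).indicator fun _ => (1 : ℝ) := by
        funext ω
        by_cases h1 : ω ∈ B <;> by_cases h2 : (N : ℝ) < |g k ω| <;>
          simp [Set.indicator, h1, h2]
      have hm : MeasurableSet (B ∩ {ω | (N : ℝ) < |g k ω|}) := hBm.inter (hg k hS)
      rw [e, integral_indicator_const _ hm, smul_eq_mul, mul_one]
  have hset : B ∩ {ω | ∃ k ∈ Finset.range N, (N : ℝ) < |g k ω|}
      = ⋃ k ∈ Finset.range N, B ∩ {ω | (N : ℝ) < |g k ω|} := by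
    ext ω
    simp
  rw [hset]
  refine (measureReal_biUnion_finset_le _ _).trans ?_
  simp only [hterm]
  rw [Finset.sum_const, Finset.card_range, nsmul_eq_mul, ← integral_const_mul]
  -- On B the integrand is T_N(1) ≤ R_N(1) < δ, and off B it vanishes.
  calc ∫ ω, N * (B.indicator (fun _ => (1 : ℝ)) ω * (tailLaw μ g ω).real {x | (N : ℝ) < |x|}) ∂μ
      ≤ ∫ _, δ ∂μ := by
        refine integral_mono_of_nonneg (Eventually.of_forall fun ω => ?_) (integrable_const _)
          (Eventually.of_forall fun ω => ?_)
        · have : 0 ≤ B.indicator (fun _ => (1 : ℝ)) ω :=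
            Set.indicator_nonneg (fun _ _ => zero_le_one) ω
          simp only [Pi.zero_apply]
          positivity
        · by_cases hω : ω ∈ B
          · have h1 := condTail_le_condTruncSecond (μ := μ) (g := g) hN' ω
            rw [condTail, one_mul] at h1
            simp only [hω, Set.indicator_of_mem, one_mul]
            exact h1.trans (le_of_lt hω)
          · simpa [hω] using hδ.le
    _ = δ := by simp

/-- On a tail event where the truncated second moment is small, the average of the truncated terms
is close to the truncated conditional mean. -/
lemma Exchangeable.measure_truncated_average_le (hex : Exchangeable μ g)
    (hg : ∀ n, Measurable (g n)) {N : ℕ} (hN : 0 < N) {δ : ℝ} (hδ : 0 < δ) {ε : ℝ} (hε : 0 < ε) :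
    μ.real ({ω | condTruncSecond μ g 1 N ω < δ} ∩
      {ω | ε < |1 / (N : ℝ) * ∑ k ∈ Finset.range N, trunc N (g k ω) - condMean μ g 1 N ω|})
      ≤ δ / ε ^ 2 := by
  have hN' : (0 : ℝ) < N := by positivity
  set B := {ω | condTruncSecond μ g 1 N ω < δ} with hBdef
  have hB : MeasurableSet[tail g] B := measurable_condTruncSecond 1 N measurableSet_Iio
  have hBm := tail_le hg B hB
  have hw : Measurable[tail g] (B.indicator fun _ => (1 : ℝ)) :=
    (@measurable_const _ _ _ (tail g) (1 : ℝ)).indicator hB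
  have hw1 : ∀ ω, |B.indicator (fun _ => (1 : ℝ)) ω| ≤ 1 := fun ω => by
    by_cases h : ω ∈ B <;> simp [h]
  have hC : ∀ x, |trunc N x| ≤ N := fun x => by
    simpa using abs_trunc_le (N : ℝ) x
  have hms := hex.integral_tail_mul_sq_sum hg (measurable_trunc N) hC hw hw1 N
  set Y : Ω → ℝ := fun ω => 1 / (N : ℝ) * ∑ k ∈ Finset.range N, trunc N (g k ω)
    - condMean μ g 1 N ω with hY
  have hcm : ∀ ω, condMean μ g 1 N ω = ∫ x, trunc N x ∂(tailLaw μ g ω) := fun ω => by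
    rw [condMean, one_mul]
  have hYsum : ∀ ω, Y ω ^ 2 = 1 / (N : ℝ) ^ 2 * (∑ k ∈ Finset.range N,
      (trunc N (g k ω) - ∫ x, trunc N x ∂(tailLaw μ g ω))) ^ 2 := fun ω => by
    rw [Finset.sum_sub_distrib, Finset.sum_const, Finset.card_range, nsmul_eq_mul, hY]
    simp only [hcm]
    field_simp
  have hYm : Measurable Y :=
    ((Finset.measurable_sum _ fun k _ => (measurable_trunc N).comp (hg k)).const_mul _).sub
      ((measurable_condMean 1 N).mono (tail_le hg) le_rfl)
  -- The normalization 1/N² against N variances leaves 1/N times the conditional variance, at most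
  -- Σ_N(1) ≤ R_N(1), which is below δ on B.
  have hbound : ∫ ω, B.indicator (fun _ => (1 : ℝ)) ω * Y ω ^ 2 ∂μ ≤ δ := by
    have e : ∫ ω, B.indicator (fun _ => (1 : ℝ)) ω * Y ω ^ 2 ∂μ = 1 / (N : ℝ) *
        ∫ ω, B.indicator (fun _ => (1 : ℝ)) ω * (∫ x, trunc N x ^ 2 ∂(tailLaw μ g ω)
          - (∫ x, trunc N x ∂(tailLaw μ g ω)) ^ 2) ∂μ := by
      simp only [hYsum, mul_left_comm _ (1 / (N : ℝ) ^ 2)]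
      rw [integral_const_mul, hms]
      field_simp
    rw [e, ← integral_const_mul]
    calc _ ≤ ∫ _, δ ∂μ := by
          refine integral_mono_of_nonneg (Eventually.of_forall fun ω => ?_) (integrable_const _)
            (Eventually.of_forall fun ω => ?_)
          · have h1 : 0 ≤ B.indicator (fun _ => (1 : ℝ)) ω :=
              Set.indicator_nonneg (fun _ _ => zero_le_one) ω
            have h2 := sq_integral_trunc_le (tailLaw μ g ω) N
            simp only [← trunc_sq] at h2
            have h3 := sub_nonneg.2 h2
            simp only [Pi.zero_apply]
            positivity
          · by_cases hω : ω ∈ B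
            · have h1 := condSecond_le_condTruncSecond (μ := μ) (g := g) hN' ω
              simp only [condSecond, one_mul, ← trunc_sq] at h1
              simp only [hω, Set.indicator_of_mem, one_mul]
              refine le_trans ?_ (h1.trans (le_of_lt hω))
              refine mul_le_mul_of_nonneg_left ?_ (by positivity)
              linarith [sq_nonneg (∫ x, trunc N x ∂(tailLaw μ g ω))]
            · simpa [hω] using hδ.le
      _ = δ := by simp
  have hYb : ∀ ω, |Y ω| ≤ 2 * N := fun ω => by
    have h1 : |1 / (N : ℝ) * ∑ k ∈ Finset.range N, trunc N (g k ω)| ≤ N := by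
      rw [abs_mul, abs_of_pos (by positivity : (0 : ℝ) < 1 / N), one_div, inv_mul_le_iff₀ hN']
      refine (Finset.abs_sum_le_sum_abs _ _).trans ?_
      refine (Finset.sum_le_card_nsmul _ _ _ fun k _ => hC (g k ω)).trans ?_
      simp
    have h2 : |condMean μ g 1 N ω| ≤ N := by
      rw [hcm]; exact norm_integral_tailLaw_le (f := trunc N) (fun x => hC x) ω
    have h3 := abs_sub (1 / (N : ℝ) * ∑ k ∈ Finset.range N, trunc N (g k ω)) (condMean μ g 1 N ω)
    calc |Y ω| ≤ _ := h3
      _ ≤ 2 * N := by linarith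
  have hInt : Integrable (fun ω => B.indicator (fun _ => (1 : ℝ)) ω * Y ω ^ 2) μ := by
    refine Integrable.bdd_mul (c := 1) (Integrable.of_bound (hYm.pow_const 2).aestronglyMeasurable
      ((2 * N) ^ 2) (Eventually.of_forall fun ω => ?_))
      (hw.mono (tail_le hg) le_rfl).aestronglyMeasurable (Eventually.of_forall hw1)
    rw [norm_pow]
    exact pow_le_pow_left₀ (norm_nonneg _) (hYb ω) 2
  rw [le_div_iff₀ (by positivity), mul_comm]
  refine le_trans ?_ (le_trans (mul_meas_ge_le_integral_of_nonneg (μ := μ)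
    (Eventually.of_forall fun ω => ?_) hInt (ε ^ 2)) hbound)
  · refine mul_le_mul_of_nonneg_left (measureReal_mono fun ω hω => ?_) (sq_nonneg ε)
    have h1 : ε < |Y ω| := hω.2
    have h2 : ω ∈ B := hω.1
    simp only [Set.mem_ofPred_eq, h2, Set.indicator_of_mem, one_mul]
    rw [← sq_abs (Y ω)]
    gcongr
  · exact mul_nonneg (Set.indicator_nonneg (fun _ _ => zero_le_one) ω) (sq_nonneg _)

/-- The truncation condition implies the weak law, with the truncated conditional means as
correctors. -/
theorem Exchangeable.wlln_condMean (hex : Exchangeable μ g) (hg : ∀ n, Measurable (g n))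
    (h : TendstoInMeasure μ (fun N : ℕ => condTruncSecond μ g 1 N) atTop (fun _ => (0 : ℝ))) :
    WLLN μ g (fun N : ℕ => condMean μ g 1 N) := by
  refine ⟨fun N => measurable_condMean 1 N, fun ε hε => ?_⟩
  rw [tendstoInMeasure_iff_measureReal_norm] at h
  refine Metric.tendsto_atTop'.2 fun η hη => ?_
  obtain ⟨δ, hδ, hδη⟩ : ∃ δ : ℝ, 0 < δ ∧ δ + δ / ε ^ 2 ≤ η / 2 := by
    refine ⟨η / 2 / (1 + 1 / ε ^ 2), by positivity, le_of_eq ?_⟩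
    field_simp
  obtain ⟨n₀, hn₀⟩ := Metric.tendsto_atTop'.1 (h δ hδ) (η / 2) (half_pos hη)
  refine ⟨n₀, fun N hN => ?_⟩
  have hlast := hn₀ N hN
  -- `Metric.tendsto_atTop'` provides the strict inequality n₀ < N, which excludes N = 0.
  have hN0 : 0 < N := by omega
  have hN' : (0 : ℝ) < N := by positivity
  rw [Real.dist_eq, sub_zero, abs_of_nonneg measureReal_nonneg] at hlast ⊢
  have h1 := hex.measure_exists_lt_abs_le hg hN0 hδ
  have h2 := hex.measure_truncated_average_le hg hN0 hδ hε
  set S1 := {ω | condTruncSecond μ g 1 N ω < δ} ∩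
      {ω | ∃ k ∈ Finset.range N, (N : ℝ) < |g k ω|}
  set S2 := {ω | condTruncSecond μ g 1 N ω < δ} ∩
      {ω | ε < |1 / (N : ℝ) * ∑ k ∈ Finset.range N, trunc N (g k ω) - condMean μ g 1 N ω|}
  set S3 := {ω | δ ≤ ‖condTruncSecond μ g 1 N ω - 0‖}
  -- Outside the first two exceptional sets no term exceeds N, so the average equals its truncated
  -- version.
  have hsub : {ω | ε < |avg g N ω - condMean μ g 1 N ω|} ⊆ S3 ∪ (S1 ∪ S2) := fun ω hω => by
    by_cases h3 : condTruncSecond μ g 1 N ω < δ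
    · refine Or.inr ?_
      by_cases h4 : ∃ k ∈ Finset.range N, (N : ℝ) < |g k ω|
      · exact Or.inl ⟨h3, h4⟩
      · refine Or.inr ⟨h3, ?_⟩
        push Not at h4
        have e : ∑ k ∈ Finset.range N, trunc N (g k ω) = ∑ k ∈ Finset.range N, g k ω :=
          Finset.sum_congr rfl fun k hk => by simp [trunc, Set.indicator, h4 k hk]
        simp only [Set.mem_ofPred_eq, e]
        exact hω
    · refine Or.inl ?_
      simp only [S3, Set.mem_ofPred_eq, sub_zero]
      exact (not_lt.1 h3).trans (le_abs_self _)
  calc μ.real {ω | ε < |avg g N ω - condMean μ g 1 N ω|}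
      ≤ μ.real S3 + (μ.real S1 + μ.real S2) :=
        (measureReal_mono hsub).trans ((measureReal_union_le _ _).trans
          (by gcongr; exact measureReal_union_le _ _))
    _ < η := by linarith

/-- Correctors are of smaller order than the square root of `N`. -/
theorem Exchangeable.tendsto_corrector_div_sqrt (hex : Exchangeable μ g)
    (hg : ∀ n, Measurable (g n)) (h : WLLN μ g D) :
    TendstoInMeasure μ (fun (N : ℕ) (ω : Ω) => D N ω / √(N : ℝ)) atTop (fun _ => (0 : ℝ)) := by
  have hR := hex.tendsto_condTruncSecond_of_wlln hg h
  have h1 := h.tendstoInMeasure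
  have h2 := (hex.wlln_condMean hg hR).tendstoInMeasure
  -- By Jensen, Δ_N(1)²/N ≤ Σ_N(1) ≤ R_N(1).
  have hΔ : TendstoInMeasure μ (fun (N : ℕ) ω => condMean μ g 1 N ω / √(N : ℝ)) atTop
      (fun _ => (0 : ℝ)) := by
    rw [tendstoInMeasure_iff_measureReal_norm] at hR ⊢
    intro δ hδ
    refine squeeze_zero' (Eventually.of_forall fun n => measureReal_nonneg) ?_
      (hR (δ ^ 2) (by positivity))
    filter_upwards [eventually_gt_atTop 0] with N hN
    have hN' : (0 : ℝ) < N := by positivity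
    refine measureReal_mono fun ω hω => ?_
    simp only [Set.mem_ofPred_eq, sub_zero, Real.norm_eq_abs] at hω ⊢
    refine le_trans ?_ (le_abs_self _)
    calc δ ^ 2 ≤ |condMean μ g 1 N ω / √(N : ℝ)| ^ 2 := by gcongr
      _ = 1 / N * condMean μ g 1 N ω ^ 2 := by
        rw [sq_abs, div_pow, Real.sq_sqrt hN'.le]; ring
      _ ≤ condSecond μ g 1 N ω :=
        mul_le_mul_of_nonneg_left (sq_integral_trunc_le _ _) (by positivity)
      _ ≤ condTruncSecond μ g 1 N ω := condSecond_le_condTruncSecond hN' ω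
  have hsqrt : ∀ {F : ℕ → Ω → ℝ}, TendstoInMeasure μ F atTop (fun _ => (0 : ℝ)) →
      ∀ s : ℝ, |s| = 1 →
      TendstoInMeasure μ (fun N ω => s * F N ω / √(N : ℝ)) atTop (fun _ => (0 : ℝ)) :=
    fun {F} hF s hs => by
      refine tendstoInMeasure_zero_of_abs_le hF 1 ?_
      filter_upwards [eventually_gt_atTop 0] with N hN
      refine Eventually.of_forall fun ω => ?_
      rw [abs_div, abs_mul, hs, one_mul, abs_of_nonneg (Real.sqrt_nonneg _)]
      refine div_le_self (abs_nonneg _) (Real.one_le_sqrt.2 ?_)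
      exact_mod_cast hN
  -- Decomposition D = -(avg - D) + (avg - Δ) + Δ, each term divided by √N.
  refine (tendstoInMeasure_zero_add (tendstoInMeasure_zero_add (hsqrt h1 (-1) (by simp))
    (hsqrt h2 1 (by simp))) hΔ).congr_left fun N => Eventually.of_forall fun ω => ?_
  simp only
  ring

end Sufficiency

end ExchWLLN

/-! ### Assembly of the equivalences -/

theorem theorem6p1 {Ω : Type*} [MeasurableSpace Ω] (μ : Measure Ω) [IsProbabilityMeasure μ]
    (g : ℕ → Ω → ℝ) (hg : ∀ n, Measurable (g n)) (hexch : ExchWLLN.Exchangeable μ g) :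
    List.TFAE [
      ∃ D : ℕ → Ω → ℝ, ExchWLLN.WLLN μ g D,
      ∃ D : ℕ → Ω → ℝ, ExchWLLN.CondWLLN μ g D,
      ∀ ε : ℝ, 0 < ε →
        TendstoInMeasure μ (fun t : ℝ => ExchWLLN.condTail μ g ε t) atTop (fun _ => (0 : ℝ)) ∧
        TendstoInMeasure μ (fun t : ℝ => ExchWLLN.condSecond μ g ε t) atTop (fun _ => (0 : ℝ)),
      ∀ ε : ℝ, 0 < ε →
        TendstoInMeasure μ (fun t : ℝ => ExchWLLN.condTail μ g ε t) atTop (fun _ => (0 : ℝ)) ∧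
        TendstoInMeasure μ (fun t : ℝ => ExchWLLN.condVariance μ g ε t) atTop (fun _ => (0 : ℝ)),
      ∀ ε : ℝ, 0 < ε →
        TendstoInMeasure μ (fun t : ℝ => ExchWLLN.condTruncSecond μ g ε t) atTop
          (fun _ => (0 : ℝ)),
      ∀ ε : ℝ, 0 < ε →
        TendstoInMeasure μ
          (fun (M : ℝ) (ω : Ω) => (1 / M) * ∫ t in Set.Ioc 0 M, ExchWLLN.condTail μ g ε t ω)
          atTop (fun _ => (0 : ℝ)),
      ∀ ε : ℝ, 0 < ε →
        TendstoInMeasure μ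
          (fun (M : ℝ) (ω : Ω) => M * ∫ t in Set.Ioi M, ExchWLLN.condSecond μ g ε t ω / t ^ 2)
          atTop (fun _ => (0 : ℝ)),
      ∀ ε : ℝ, 0 < ε →
        TendstoInMeasure μ
          (fun (M : ℝ) (ω : Ω) => M * ∫ t in Set.Ioi M, ExchWLLN.condVariance μ g ε t ω / t ^ 2)
          atTop (fun _ => (0 : ℝ))] ∧
    -- under these conditions the truncated conditional means can serve as correctors
    ((∃ D : ℕ → Ω → ℝ, ExchWLLN.WLLN μ g D) →
      ExchWLLN.WLLN μ g (fun N : ℕ => ExchWLLN.condMean μ g 1 N) ∧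
      ExchWLLN.CondWLLN μ g (fun N : ℕ => ExchWLLN.condMean μ g 1 N)) ∧
    -- all correctors are of smaller order than the square root of `N`
    (∀ D : ℕ → Ω → ℝ, ExchWLLN.WLLN μ g D ∨ ExchWLLN.CondWLLN μ g D →
      TendstoInMeasure μ (fun (N : ℕ) (ω : Ω) => D N ω / √(N : ℝ)) atTop
        (fun _ => (0 : ℝ))) := by
  open ExchWLLN in
  have hnat : (∀ ε : ℝ, 0 < ε → TendstoInMeasure μ
      (fun t : ℝ => condTruncSecond μ g ε t) atTop (fun _ => (0 : ℝ))) →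
      WLLN μ g (fun N : ℕ => condMean μ g 1 N) := fun h =>
    hexch.wlln_condMean hg ((h 1 one_pos).comp tendsto_natCast_atTop_atTop)
  open ExchWLLN in
  have hR : ∀ D : ℕ → Ω → ℝ, WLLN μ g D → ∀ ε : ℝ, 0 < ε → TendstoInMeasure μ
      (fun t : ℝ => condTruncSecond μ g ε t) atTop (fun _ => (0 : ℝ)) := fun D h ε hε =>
    tendsto_condTruncSecond_of_nat (hexch.tendsto_condTruncSecond_of_wlln hg h) hε
  refine ⟨?_, ?_, ?_⟩
  · tfae_have 1 ↔ 2 := exists_congr fun D => ExchWLLN.wlln_iff_condWLLN hg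
    tfae_have 1 → 5 := fun ⟨D, hD⟩ => hR D hD
    tfae_have 5 → 1 := fun h => ⟨_, hnat h⟩
    tfae_have 5 ↔ 3 := forall₂_congr fun ε hε => ExchWLLN.tendsto_condTruncSecond_iff hε
    tfae_have 4 ↔ 3 := forall₂_congr fun ε _ =>
      and_congr_right fun _ => ExchWLLN.tendsto_condVariance_iff hg ε
    tfae_have 6 ↔ 5 := forall₂_congr fun ε hε => ExchWLLN.tendsto_average_condTail_iff hε
    tfae_have 7 ↔ 5 := forall₂_congr fun ε hε => ExchWLLN.tendsto_average_condSecond_iff hε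
    tfae_have 8 ↔ 7 := forall₂_congr fun ε hε => ExchWLLN.tendsto_average_condVariance_iff hg hε
    tfae_finish
  · rintro ⟨D, hD⟩
    exact ⟨hnat (hR D hD), (ExchWLLN.wlln_iff_condWLLN hg).1 (hnat (hR D hD))⟩
  · intro D hD
    exact hexch.tendsto_corrector_div_sqrt hg
      (hD.elim id (ExchWLLN.wlln_iff_condWLLN hg).2)
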